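/- **Online preemptive model.** The distinct edges $e_1,\dots,e_m$ of a simple graph are revealed one by one. After each arrival the algorithm holds a matching $M$ of revealed edges, starting from $M=\emptyset$. On receipt of $e$ it either rejects $e$ ($M$ is unchanged) or accepts $e$, in which case all edges of $M$ adjacent to $e$ are discarded. A randomized algorithm is *$\alpha$-competitive* on a class of inputs if, for every input $\sigma$ in the class, the expected cardinality of its output matching after $\sigma$ is at least $\frac1\alpha$ times the maximum cardinality of a matching in the graph formed by $\sigma$. A *growing tree* is a finite sequence of distinct edges such that after each arrival the graph formed by the revealed edges (on the set of their endpoints) is a tree. **The four-matching algorithm.** Maintain four edge sets $M_1,M_2,M_3,M_4$, initially empty. When an edge $e$ arrives: 1. (Augment phase) add $e$ to every $M_i$ that contains no edge adjacent to $e$. 2. (Switching phase) for $i=2,3,4$, in this order: if $e$ was not added to $M_i$ in the augment phase, then replace $M_i$ by $M_i'=\{e\}\cup\{f\in M_i : f \text{ not adjacent to } e\}$, provided that this strictly decreases $\sum_{i,j\in\{1,2,3,4\},\, i\ne j}|M_i\cap M_j|$, computed with the current sets. Two fair random bits, drawn once, select one index $i\in\{1,2,3,4\}$ uniformly (probability $\frac14$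 each), and the output after every arrival is $M_i$. **Theorem.** On growing trees the four-matching algorithm obeys the rules of the online preemptive model (for each value of the random bits), and it is $\frac{28}{15}$-competitive for maximum cardinality matching: for every growing tree $\sigma$, $$\frac14\sum_{i=1}^4 |M_i(\sigma)| \;\ge\; \frac{15}{28}\,\mathrm{opt}(\sigma),$$ where $M_i(\sigma)$ is the $i$-th matching after $\sigma$ has been processed and $\mathrm{opt}(\sigma)$ is the maximum cardinality of a matching in the tree formed by the edges of $\sigma$. -/

import Mathlib

namespace OnlineMatching

section Model

variable {V : Type*} [DecidableEq V]

/-- Two edges are adjacent (in conflict) if they are distinct and share an endpoint. -/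
def Adjacent (e f : Sym2 V) : Prop := e ≠ f ∧ ∃ v ∈ e.toFinset, v ∈ f.toFinset

instance (e f : Sym2 V) : Decidable (Adjacent e f) :=
  inferInstanceAs (Decidable (e ≠ f ∧ ∃ v ∈ e.toFinset, v ∈ f.toFinset))

/-- A set of edges is a matching if no two of its edges are adjacent. -/
def IsMatching (M : Finset (Sym2 V)) : Prop := ∀ e ∈ M, ∀ f ∈ M, ¬ Adjacent e f

instance (M : Finset (Sym2 V)) : Decidable (IsMatching M) :=
  inferInstanceAs (Decidable (∀ e ∈ M, ∀ f ∈ M, ¬ Adjacent e f))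

/-- The offline optimum: the maximum cardinality of a matching among the edges of the
input sequence `σ`. -/
def opt (σ : List (Sym2 V)) : ℕ :=
  (σ.toFinset.powerset.filter IsMatching).sup Finset.card

/-- Accepting the edge `e`: it is put into `M` and the adjacent edges are discarded. -/
def accept (e : Sym2 V) (M : Finset (Sym2 V)) : Finset (Sym2 V) :=
  insert e (M.filter fun f => ¬ Adjacent e f)

/-- A randomized online algorithm with random seed in `Ω`. Given the seed `ω`, the output
after the edges of `σ` have been revealed in this order is `output ω σ`; it depends on the
revealed edges only. -/
structure RandomizedAlgorithm (Ω V : Type*) where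
  law : PMF Ω
  output : Ω → List (Sym2 V) → Finset (Sym2 V)

/-- The algorithm obeys the rules of the online preemptive model on the inputs in `C`, for
every seed: it starts from the empty set, each newly revealed edge is either rejected or
accepted (in the latter case the adjacent edges are discarded), and the current output is always
a matching that consists of revealed edges. -/
def RandomizedAlgorithm.IsPreemptiveOn {Ω : Type*} (A : RandomizedAlgorithm Ω V)
    (C : Set (List (Sym2 V))) : Prop :=
  ∀ ω : Ω, A.output ω [] = ∅ ∧
    (∀ (σ : List (Sym2 V)) (e : Sym2 V), σ ++ [e] ∈ C →
      A.output ω (σ ++ [e]) = A.output ω σ ∨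
        A.output ω (σ ++ [e]) = accept e (A.output ω σ)) ∧
    ∀ σ ∈ C, IsMatching (A.output ω σ) ∧ A.output ω σ ⊆ σ.toFinset

/-- The expected cardinality of the output after the edges of `σ` have been revealed. -/
noncomputable def RandomizedAlgorithm.expectedSize {Ω : Type*} [Fintype Ω]
    (A : RandomizedAlgorithm Ω V) (σ : List (Sym2 V)) : ℝ :=
  ∑ ω, (A.law ω).toReal * ((A.output ω σ).card : ℝ)

/-- The algorithm is `α`-competitive for maximum cardinality matching on the inputs in `C`. -/
def RandomizedAlgorithm.IsCompetitiveOn {Ω : Type*} [Fintype Ω]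
    (A : RandomizedAlgorithm Ω V) (C : Set (List (Sym2 V))) (α : ℝ) : Prop :=
  ∀ σ ∈ C, (1 / α) * (opt σ : ℝ) ≤ A.expectedSize σ

end Model

section GrowingTrees

variable {V : Type*}

/-- The graph formed by the edges in `σ`. -/
def inputGraph (σ : List (Sym2 V)) : SimpleGraph V := SimpleGraph.fromEdgeSet {e | e ∈ σ}

/-- Growing trees: the input consists of distinct edges (no loops), and after every arrival the
graph formed by the revealed edges, on the set of their endpoints, is a tree. -/
def IsGrowingTree (σ : List (Sym2 V)) : Prop :=
  σ.Nodup ∧ (∀ e ∈ σ, ¬ e.IsDiag) ∧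
    ∀ τ : List (Sym2 V), τ <+: σ → τ ≠ [] →
      ((inputGraph τ).induce (inputGraph τ).support).IsTree

end GrowingTrees

section Algorithm

variable {V : Type*} [DecidableEq V]

/-- The overlap `∑_{i ≠ j} |M i ∩ M j|` of four edge sets. -/
def overlap (M : Fin 4 → Finset (Sym2 V)) : ℕ :=
  ∑ p ∈ (Finset.univ : Finset (Fin 4)).offDiag, (M p.1 ∩ M p.2).card

/-- The augment phase: `e` is added to each `M i` that has no edge adjacent to `e`. -/
def augment (e : Sym2 V) (M : Fin 4 → Finset (Sym2 V)) : Fin 4 → Finset (Sym2 V) :=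
  fun i => if ∀ f ∈ M i, ¬ Adjacent e f then insert e (M i) else M i

/-- Switching for the single index `i`: if `e` is not in `M i` yet, then it is accepted into `M i`
provided that this decreases the overlap. -/
def switchAt (e : Sym2 V) (M : Fin 4 → Finset (Sym2 V)) (i : Fin 4) :
    Fin 4 → Finset (Sym2 V) :=
  if e ∉ M i ∧ overlap (Function.update M i (accept e (M i))) < overlap M then
    Function.update M i (accept e (M i))
  else M

/-- Processing of a new edge: the augment phase, then the switching phase for the second, third
and fourth matching in this order (the indices are `0, 1, 2, 3`). -/
def step (M : Fin 4 → Finset (Sym2 V)) (e : Sym2 V) : Fin 4 → Finset (Sym2 V) :=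
  [1, 2, 3].foldl (switchAt e) (augment e M)

/-- The four matchings after the edges of `σ` have been processed in order. -/
def matchings (σ : List (Sym2 V)) : Fin 4 → Finset (Sym2 V) :=
  σ.foldl step fun _ => ∅

/-- Two bits as an index of one of the four matchings. -/
def bitsIndex : Bool × Bool → Fin 4
  | (false, false) => 0
  | (false, true) => 1
  | (true, false) => 2
  | (true, true) => 3

variable (V) in
/-- The four-matching algorithm: two fair random bits select the matching to be output. -/
noncomputable def fourMatching : RandomizedAlgorithm (Bool × Bool) V where
  law := PMF.uniformOfFintype (Bool × Bool)
  output := fun b σ => matchings σ (bitsIndex b)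

end Algorithm

end OnlineMatching

/-! The proof is a charging argument. Call the set of indices `i` with `f ∈ M i` the label of `f`;
label sizes add up to `∑ |M i|`. An edge with a label of size `k` hands at most `4k` units to its
endpoints. If the endpoints of every revealed edge together receive at least 9, then summing over an
optimal matching gives `9 opt ≤ 4 ∑ |M i|`, and `9/16 > 15/28`.

In a growing tree the arriving edge `e = vw` has a new endpoint `w`, so all conflicts are at `v`.
There the four indices are distributed among the edges at `v` (free ones go to `e`), and a switch
pays off exactly when it balances the distribution. A finite check (`stealOutcome_fin`) shows that
at most one old edge loses indices, from 4 or 3 to 2, or from 2 to 1. Hence live edges (nonempty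
label) stay live and live degrees never drop. Index `1` switches first and thereby breaks ties: a
label cut down to size 2 misses `1`, and among two labels of size 2 at `v` the one with `1` loses.
So a size-2 label without `1` loses an index only at a vertex that reaches live degree 4.

Labels of size at least 2 pay both endpoints equally. A singleton pays 1 to its lower endpoint and 3
to the other, and a flag shifts one unit away from the vertex where the loss occurred. By
`Invariant`, a vertex is the lower endpoint of at most one live edge and suffers at most one shift,
so live degree 4 yields `4·3 - 2 - 1 = 9`; degree 3 yields 8, thanks to a reserve edge that pays 4
instead of 3. `Invariant.nine_le_weight_add_weight` combines these bounds according to the label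
size. -/

namespace OnlineMatching

/-! ### The switching phase as a balancing game on four indices -/

section Stealing

variable {α β : Type*} [DecidableEq α] [DecidableEq β]

/-- The indices that are assigned to `a`. -/
def fiber (g : Fin 4 → α) (a : α) : Finset (Fin 4) := Finset.univ.filter fun i => g i = a

/-- The switching rule for the index `i`, in terms of the assignment `g` of the four indices to
edges: the edge `e` takes over `i` if this makes the numbers of indices more balanced. -/
def steal (e : α) (g : Fin 4 → α) (i : Fin 4) : Fin 4 → α :=
  if g i ≠ e ∧ (fiber g e).card + 1 < (fiber g (g i)).card then Function.update g i e else g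

/-- The possible effects of the switching phase on the assignment of the indices. -/
def StealOutcome (e : α) (g g' : Fin 4 → α) : Prop :=
  (g' = g ∧ ∀ i, g i ≠ e → (fiber g (g i)).card ≤ (fiber g e).card + 1) ∨
  ∃ i, g i ≠ e ∧ (∀ j, g' j = g j ∨ g j = g i ∧ g' j = e) ∧
    (((fiber g (g i)).card = 4 ∧ (fiber g' e).card = 2 ∧ (fiber g' (g i)).card = 2 ∧ g' 1 ≠ g i ∨
      (fiber g (g i)).card = 3 ∧ (fiber g' e).card = 2 ∧ (fiber g' (g i)).card = 2 ∧ g' 1 ≠ g i ∨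
      (fiber g (g i)).card = 3 ∧ (fiber g e).card = 0 ∧ (fiber g' e).card = 1 ∧
        (fiber g' (g i)).card = 2 ∧ g' 1 ≠ g i) ∨
      (fiber g (g i)).card = 2 ∧ (fiber g e).card = 0 ∧ (fiber g' e).card = 1 ∧
        (fiber g' (g i)).card = 1 ∧ ∀ j, g j ≠ g i → (fiber g (g j)).card = 2 → g 1 = g i)

instance (e : α) (g g' : Fin 4 → α) : Decidable (StealOutcome e g g') := by
  unfold StealOutcome; infer_instance

/-- Only equalities among `e` and the four values of `g` matter, so five names suffice. The clauses
about index `1` reflect that it is the first to be considered. -/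
theorem stealOutcome_fin : ∀ a b c d : Fin 5,
    StealOutcome 0 ![a, b, c, d] ([1, 2, 3].foldl (steal 0) ![a, b, c, d]) := by
  decide +kernel

theorem fiber_comp {s : Set α} {κ : α → β} (hκ : Set.InjOn κ s) {g : Fin 4 → α}
    (hg : ∀ i, g i ∈ s) {a : α} (ha : a ∈ s) : fiber (κ ∘ g) (κ a) = fiber g a := by
  ext i
  simp [fiber, hκ.eq_iff (hg i) ha]

/-- The rule only compares values, hence commutes with a renaming that is injective on those in
play. -/
theorem steal_comp {s : Set α} {κ : α → β} (hκ : Set.InjOn κ s) {g : Fin 4 → α}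
    (hg : ∀ i, g i ∈ s) {e : α} (he : e ∈ s) (i : Fin 4) :
    steal (κ e) (κ ∘ g) i = κ ∘ steal e g i ∧ ∀ j, steal e g i j ∈ s := by
  have h1 : fiber (κ ∘ g) (κ (g i)) = fiber g (g i) := fiber_comp hκ hg (hg i)
  have h2 : κ (g i) = κ e ↔ g i = e := hκ.eq_iff (hg i) he
  unfold steal
  simp only [Function.comp_apply, h1, fiber_comp hκ hg he, ne_eq, h2]
  split_ifs with h
  · refine ⟨(Function.comp_update _ _ _ _).symm, fun j => ?_⟩
    by_cases hj : j = i
    · subst hj; simpa using he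
    · simpa [hj] using hg j
  · exact ⟨rfl, hg⟩

theorem StealOutcome.of_comp {s : Set α} {κ : α → β} (hκ : Set.InjOn κ s) {g g' : Fin 4 → α}
    (hg : ∀ i, g i ∈ s) (hg' : ∀ i, g' i ∈ s) {e : α} (he : e ∈ s)
    (h : StealOutcome (κ e) (κ ∘ g) (κ ∘ g')) : StealOutcome e g g' := by
  have h0 : ∀ i, κ (g i) = κ e ↔ g i = e := fun i => hκ.eq_iff (hg i) he
  have h1 : ∀ i, κ (g' i) = κ e ↔ g' i = e := fun i => hκ.eq_iff (hg' i) he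
  have h2 : ∀ i j, κ (g i) = κ (g j) ↔ g i = g j := fun i j => hκ.eq_iff (hg i) (hg j)
  have h3 : ∀ i j, κ (g' i) = κ (g j) ↔ g' i = g j := fun i j => hκ.eq_iff (hg' i) (hg j)
  have h4 : κ ∘ g' = κ ∘ g ↔ g' = g := by
    simp only [funext_iff, Function.comp_apply, h3]
  have h5 : ∀ i, fiber (κ ∘ g) (κ (g i)) = fiber g (g i) := fun i => fiber_comp hκ hg (hg i)
  have h6 : ∀ i, fiber (κ ∘ g') (κ (g i)) = fiber g' (g i) := fun i => fiber_comp hκ hg' (hg i)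
  simpa only [StealOutcome, Function.comp_apply, ne_eq, h0, h1, h2, h3, h4, h5, h6,
    fiber_comp hκ hg he, fiber_comp hκ hg' he] using h

theorem stealOutcome_foldl (e : α) (g : Fin 4 → α) :
    StealOutcome e g ([1, 2, 3].foldl (steal e) g) := by
  classical
  -- Within `s`, the default `4` can only be the name of `g 3`, so `κ` is injective there.
  let κ : α → Fin 5 := fun x => if x = e then 0 else if x = g 0 then 1 else
    if x = g 1 then 2 else if x = g 2 then 3 else 4
  let s : Set α := {x | x = e ∨ ∃ i, x = g i}
  have hκ : Set.InjOn κ s := by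
    intro x hx y hy hxy
    simp [s, Fin.exists_fin_succ] at hx hy
    simp only [κ] at hxy
    split_ifs at hxy <;> simp_all
  have hg : ∀ i, g i ∈ s := fun i => Or.inr ⟨i, rfl⟩
  have he : e ∈ s := Or.inl rfl
  have c1 := steal_comp hκ hg he 1
  have c2 := steal_comp hκ c1.2 he 2
  have c3 := steal_comp hκ c2.2 he 3
  have key := stealOutcome_fin (κ (g 0)) (κ (g 1)) (κ (g 2)) (κ (g 3))
  have hv : ![κ (g 0), κ (g 1), κ (g 2), κ (g 3)] = κ ∘ g := by
    ext i; fin_cases i <;> rfl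
  have h0 : κ e = 0 := if_pos rfl
  rw [hv, ← h0] at key
  simp only [List.foldl_cons, List.foldl_nil, c1.1, c2.1, c3.1] at key ⊢
  exact key.of_comp hκ hg c3.2 he

end Stealing

/-! ### Overlap decrease expressed by fiber sizes -/

section Switching

variable {V : Type*} [DecidableEq V]

theorem adjacent_iff {e f : Sym2 V} : Adjacent e f ↔ e ≠ f ∧ ∃ v ∈ e, v ∈ f := by
  simp [Adjacent]

/-- Only pairs involving `i` change, and each is counted in both orders. The additive form avoids
subtraction in `ℕ`. -/
theorem overlap_update (M : Fin 4 → Finset (Sym2 V)) (i : Fin 4) (A : Finset (Sym2 V)) :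
    overlap (Function.update M i A) + 2 * ∑ j ∈ Finset.univ.erase i, (M i ∩ M j).card =
      overlap M + 2 * ∑ j ∈ Finset.univ.erase i, (A ∩ M j).card := by
  have h1 : (Finset.univ : Finset (Fin 4)).offDiag =
      {(0, 1), (0, 2), (0, 3), (1, 0), (1, 2), (1, 3), (2, 0), (2, 1), (2, 3), (3, 0), (3, 1),
        (3, 2)} := by decide
  have e0 : (Finset.univ : Finset (Fin 4)).erase 0 = {1, 2, 3} := by decide
  have e1 : (Finset.univ : Finset (Fin 4)).erase 1 = {0, 2, 3} := by decide
  have e2 : (Finset.univ : Finset (Fin 4)).erase 2 = {0, 1, 3} := by decide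
  have e3 : (Finset.univ : Finset (Fin 4)).erase 3 = {0, 1, 2} := by decide
  have hc : ∀ (B : Finset (Sym2 V)) j, (M j ∩ B).card = (B ∩ M j).card := fun B j => by
    rw [Finset.inter_comm]
  fin_cases i
  · simp [overlap, h1, e0, Function.update, hc A, hc (M 0)]; ring
  · simp [overlap, h1, e1, Function.update, hc A, hc (M 1)]; ring
  · simp [overlap, h1, e2, Function.update, hc A, hc (M 2)]; ring
  · simp [overlap, h1, e3, Function.update, hc A, hc (M 3)]; ring

/-- Locally at the vertex `v`, the edge sets `M` are described by the assignment `g`, and `e`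
meets the edges in these sets only at `v`. -/
structure Describes (e : Sym2 V) (v : V) (M : Fin 4 → Finset (Sym2 V)) (g : Fin 4 → Sym2 V) :
    Prop where
  adj : ∀ i, ∀ x ∈ M i, Adjacent e x ↔ x ≠ e ∧ v ∈ x
  mem_iff : ∀ i x, v ∈ x → (x ∈ M i ↔ x = g i)
  mem : ∀ i, v ∈ g i

variable {e : Sym2 V} {v : V} {M : Fin 4 → Finset (Sym2 V)} {g : Fin 4 → Sym2 V}

theorem Describes.accept_eq (h : Describes e v M g) (i : Fin 4) :
    accept e (M i) = insert e ((M i).erase (g i)) := by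
  ext x
  simp only [accept, Finset.mem_insert, Finset.mem_filter, Finset.mem_erase]
  by_cases hx : x = e
  · simp [hx]
  · simp only [hx, false_or]
    constructor
    · rintro ⟨h1, h2⟩
      refine ⟨fun h3 => h2 ((h.adj i x h1).2 ⟨hx, h3 ▸ h.mem i⟩), h1⟩
    · rintro ⟨h1, h2⟩
      exact ⟨h2, fun h3 => h1 ((h.mem_iff i x ((h.adj i x h2).1 h3).2).1 h2)⟩

/-- Dropping `g i` saves its occurrences in the other sets, one fewer than its fiber; adding `e`
costs one for each set that already contains it. -/
theorem Describes.overlap_lt_iff (h : Describes e v M g) (he : v ∈ e) {i : Fin 4} (hi : g i ≠ e) :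
    overlap (Function.update M i (accept e (M i))) < overlap M ↔
      (fiber g e).card + 1 < (fiber g (g i)).card := by
  have key := overlap_update M i (accept e (M i))
  have h1 : ∀ j, (accept e (M i) ∩ M j).card + (if g j = g i then 1 else 0) =
      (M i ∩ M j).card + (if g j = e then 1 else 0) := by
    intro j
    have ha : accept e (M i) ∩ M j =
        if g j = e then insert e ((M i ∩ M j).erase (g i)) else (M i ∩ M j).erase (g i) := by
      have := h.mem_iff j e he
      rw [h.accept_eq]
      ext x
      split_ifs with hj <;> by_cases hx : x = e <;> simp_all [eq_comm, and_assoc]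
    have hgi : g i ∈ M i := (h.mem_iff i _ (h.mem i)).2 rfl
    have hgj : g i ∈ M j ↔ g j = g i := (h.mem_iff j _ (h.mem i)).trans eq_comm
    have he' : e ∉ (M i ∩ M j).erase (g i) := fun hh => hi
      ((h.mem_iff i e he).1 (Finset.mem_inter.1 (Finset.mem_of_mem_erase hh)).1).symm
    rw [ha]
    by_cases hj : g j = e
    · have : g j ≠ g i := fun hh => hi (hh ▸ hj)
      simp only [hj, if_true, Finset.card_insert_of_notMem he']
      rw [Finset.erase_eq_of_notMem (by simp [hgj, this]), if_neg (by rw [← hj]; exact this)]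
    · simp only [hj, if_false]
      by_cases hji : g j = g i
      · rw [if_pos hji, Finset.card_erase_add_one (Finset.mem_inter.2 ⟨hgi, hgj.2 hji⟩)]
        simp
      · rw [if_neg hji, Finset.erase_eq_of_notMem (by simp [hgj, hji])]
  have h2 := Finset.sum_congr (rfl : Finset.univ.erase i = _) fun j _ => h1 j
  rw [Finset.sum_add_distrib, Finset.sum_add_distrib] at h2
  have h3 : ∑ j ∈ Finset.univ.erase i, (if g j = g i then 1 else 0) + 1 =
      (fiber g (g i)).card := by
    rw [fiber, Finset.card_filter, ← Finset.sum_erase_add _ _ (Finset.mem_univ i), if_pos rfl]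
  have h4 : ∑ j ∈ Finset.univ.erase i, (if g j = e then 1 else 0) = (fiber g e).card := by
    rw [fiber, Finset.card_filter, ← Finset.sum_erase_add _ _ (Finset.mem_univ i), if_neg hi,
      add_zero]
  omega

theorem Describes.switchAt (h : Describes e v M g) (he : v ∈ e) (i : Fin 4) :
    Describes e v (switchAt e M i) (steal e g i) ∧
      ∀ j x, v ∉ x → (x ∈ switchAt e M i j ↔ x ∈ M j) := by
  unfold OnlineMatching.switchAt steal
  have h1 : e ∉ M i ↔ g i ≠ e := by rw [h.mem_iff i e he, ne_comm]
  have h2 : (e ∉ M i ∧ overlap (Function.update M i (accept e (M i))) < overlap M) ↔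
      (g i ≠ e ∧ (fiber g e).card + 1 < (fiber g (g i)).card) := by
    rw [h1]
    exact and_congr_right fun hi => h.overlap_lt_iff he hi
  simp only [h2]
  split_ifs with hc
  · have h3 : ∀ j x, x ∈ Function.update M i (accept e (M i)) j ↔
        if j = i then x = e ∨ x ≠ g i ∧ x ∈ M i else x ∈ M j := by
      intro j x
      by_cases hj : j = i
      · subst hj; simp [h.accept_eq]
      · simp [hj]
    refine ⟨⟨fun j x hx => ?_, fun j x hx => ?_, fun j => ?_⟩, fun j x hx => ?_⟩
    · rw [h3] at hx
      split_ifs at hx with hj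
      · rcases hx with rfl | hx
        · simp [adjacent_iff]
        · exact h.adj i x hx.2
      · exact h.adj j x hx
    · rw [h3]
      by_cases hj : j = i
      · rw [if_pos hj, hj, Function.update_self, h.mem_iff i x hx]
        exact ⟨fun hh => hh.elim id fun h' => absurd h'.2 h'.1, Or.inl⟩
      · simpa [hj] using h.mem_iff j x hx
    · by_cases hj : j = i
      · subst hj; simpa using he
      · simpa [hj] using h.mem j
    · rw [h3]
      have hxe : x ≠ e := fun hh => hx (hh ▸ he)
      have hxg : x ≠ g i := fun hh => hx (hh ▸ h.mem i)
      split_ifs with hj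
      · subst hj; simp [hxe, hxg]
      · rfl
  · exact ⟨h, fun _ _ _ => Iff.rfl⟩

end Switching

/-! ### Labels and the effect of one step -/

section Labels

variable {V : Type*} [DecidableEq V]

/-- The indices of the edge sets that contain `x`. -/
def label (M : Fin 4 → Finset (Sym2 V)) (x : Sym2 V) : Finset (Fin 4) :=
  Finset.univ.filter fun i => x ∈ M i

@[simp]
theorem mem_label {M : Fin 4 → Finset (Sym2 V)} {x : Sym2 V} {i : Fin 4} :
    i ∈ label M x ↔ x ∈ M i := by
  simp [label]

/-- The edge sets are matchings that consist of edges in `E`. -/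
def AreMatchings (E : Finset (Sym2 V)) (M : Fin 4 → Finset (Sym2 V)) : Prop :=
  ∀ i, IsMatching (M i) ∧ M i ⊆ E

theorem IsMatching.accept {N : Finset (Sym2 V)} (h : IsMatching N) (e : Sym2 V) :
    IsMatching (accept e N) := by
  have hs : ∀ x y : Sym2 V, Adjacent x y → Adjacent y x := fun x y hxy => by
    rw [adjacent_iff] at hxy ⊢
    exact ⟨hxy.1.symm, hxy.2.imp fun v hv => hv.symm⟩
  intro x hx y hy
  simp only [OnlineMatching.accept, Finset.mem_insert, Finset.mem_filter] at hx hy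
  rcases hx with rfl | hx <;> rcases hy with rfl | hy
  · exact fun hh => hh.1 rfl
  · exact hy.2
  · exact fun hh => hx.2 (hs _ _ hh)
  · exact h x hx.1 y hy.1

theorem switchAt_apply (e : Sym2 V) (M : Fin 4 → Finset (Sym2 V)) (i j : Fin 4) :
    switchAt e M i j = M j ∨ e ∉ M j ∧ switchAt e M i j = accept e (M j) := by
  unfold switchAt
  split_ifs with h
  · by_cases hj : j = i
    · subst hj; exact Or.inr ⟨h.1, by simp⟩
    · left; simp [hj]
  · exact Or.inl rfl

/-- Once `e` lies in the `j`-th set, no later switch changes that set, so the phases amount to at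
most one acceptance. -/
theorem step_apply (M : Fin 4 → Finset (Sym2 V)) (e : Sym2 V) (j : Fin 4) :
    step M e j = M j ∨ step M e j = accept e (M j) := by
  have key : ∀ (l : List (Fin 4)) (N : Fin 4 → Finset (Sym2 V)),
      l.foldl (switchAt e) N j = N j ∨ e ∉ N j ∧ l.foldl (switchAt e) N j = accept e (N j) := by
    intro l
    induction l with
    | nil => exact fun N => Or.inl rfl
    | cons i l ih =>
      intro N
      rw [List.foldl_cons]
      rcases switchAt_apply e N i j with h | h
      · have := ih (switchAt e N i)
        rwa [h] at this
      · rcases ih (switchAt e N i) with h' | h'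
        · exact Or.inr ⟨h.1, h'.trans h.2⟩
        · exact absurd (by rw [h.2]; simp [accept]) h'.1
  have ha : augment e M j = M j ∨ e ∈ augment e M j ∧ augment e M j = accept e (M j) := by
    unfold augment
    split_ifs with h
    · refine Or.inr ⟨by simp, ?_⟩
      rw [accept, Finset.filter_true_of_mem h]
    · exact Or.inl rfl
  unfold step
  rcases key [1, 2, 3] (augment e M) with h | h <;> rcases ha with h' | h'
  · exact Or.inl (h.trans h')
  · exact Or.inr (h.trans h'.2)
  · exact Or.inr (h' ▸ h.2)
  · exact absurd h'.1 h.1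

theorem AreMatchings.step {E : Finset (Sym2 V)} {M : Fin 4 → Finset (Sym2 V)}
    (h : AreMatchings E M) (e : Sym2 V) : AreMatchings (insert e E) (step M e) := by
  intro i
  rcases step_apply M e i with h' | h' <;> rw [h']
  · exact ⟨(h i).1, (h i).2.trans (Finset.subset_insert e E)⟩
  · exact ⟨(h i).1.accept e,
      Finset.insert_subset_insert e ((Finset.filter_subset _ _).trans (h i).2)⟩

/-- Distinct edges with a common endpoint have disjoint labels. -/
theorem AreMatchings.disjoint_label {E : Finset (Sym2 V)} {M : Fin 4 → Finset (Sym2 V)}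
    (h : AreMatchings E M) {x y : Sym2 V} {v : V} (hx : v ∈ x) (hy : v ∈ y) (hxy : x ≠ y) :
    Disjoint (label M x) (label M y) := by
  rw [Finset.disjoint_left]
  intro i hi hj
  rw [mem_label] at hi hj
  exact (h i).1 x hi y hj (adjacent_iff.2 ⟨hxy, v, hx, hy⟩)

theorem exists_step_describes {E : Finset (Sym2 V)} {M : Fin 4 → Finset (Sym2 V)}
    (hM : AreMatchings E M) {v w : V} (hw : ∀ f ∈ E, w ∉ f) :
    ∃ g : Fin 4 → Sym2 V, StealOutcome s(v, w) g
        ([1, 2, 3].foldl (steal s(v, w)) g) ∧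
      (∀ x, v ∈ x → x ≠ s(v, w) → label M x = fiber g x) ∧
      (∀ x, v ∈ x → label (step M s(v, w)) x =
        fiber ([1, 2, 3].foldl (steal s(v, w)) g) x) ∧
      (∀ x, v ∉ x → label (step M s(v, w)) x = label M x) ∧
      (∀ i, g i = s(v, w) ∨ g i ∈ E ∧ v ∈ g i) := by
  classical
  set e := s(v, w) with he
  have hve : v ∈ e := by simp [he]
  have heE : e ∉ E := fun h => hw e h (by simp [he])
  have hadj : ∀ x ∈ E, Adjacent e x ↔ v ∈ x := by
    intro x hx
    have hxe : e ≠ x := fun h => heE (h ▸ hx)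
    rw [adjacent_iff]
    simp only [he, Sym2.mem_iff]
    constructor
    · rintro ⟨-, a, rfl | rfl, ha⟩
      · exact ha
      · exact absurd ha (hw x hx)
    · exact fun h => ⟨hxe, v, Or.inl rfl, h⟩
  -- A matching has at most one edge at `v`, so the choice is forced. The default `e` marks the
  -- indices free at `v`, exactly those where the augment phase inserts `e`.
  let g : Fin 4 → Sym2 V := fun i => if h : ∃ f ∈ M i, v ∈ f then h.choose else e
  have g1 : ∀ i x, v ∈ x → x ∈ M i → g i = x := by
    intro i x hx hxi
    have hex : ∃ f ∈ M i, v ∈ f := ⟨x, hxi, hx⟩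
    have hg : g i = hex.choose := dif_pos hex
    by_contra hne
    exact (hM i).1 (g i) (hg ▸ hex.choose_spec.1) x hxi
      (adjacent_iff.2 ⟨hne, v, hg ▸ hex.choose_spec.2, hx⟩)
  have g2 : ∀ i, g i = e ∨ g i ∈ M i ∧ v ∈ g i := by
    intro i
    by_cases hex : ∃ f ∈ M i, v ∈ f
    · have hg : g i = hex.choose := dif_pos hex
      exact Or.inr (hg ▸ hex.choose_spec)
    · exact Or.inl (dif_neg hex)
  have g3 : ∀ i, (∀ f ∈ M i, ¬ Adjacent e f) ↔ g i = e := by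
    intro i
    constructor
    · intro h
      rcases g2 i with h' | h'
      · exact h'
      · exact absurd ((hadj _ ((hM i).2 h'.1)).2 h'.2) (h _ h'.1)
    · intro h f hf hfa
      have := g1 i f ((hadj f ((hM i).2 hf)).1 hfa) hf
      exact heE (h ▸ this ▸ (hM i).2 hf)
  have d0 : Describes e v (augment e M) g := by
    refine ⟨fun i x hx => ?_, fun i x hx => ?_, fun i => ?_⟩
    · have hx' : x = e ∨ x ∈ M i := by
        unfold augment at hx
        split_ifs at hx
        · simpa using hx
        · exact Or.inr hx
      rcases hx' with rfl | hx'
      · simp [adjacent_iff]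
      · have hxE := (hM i).2 hx'
        rw [hadj x hxE]
        exact ⟨fun h => ⟨fun h' => heE (h' ▸ hxE), h⟩, fun h => h.2⟩
    · unfold augment
      split_ifs with h
      · rw [(g3 i).1 h, Finset.mem_insert, or_iff_left]
        exact fun h' => h x h' ((hadj x ((hM i).2 h')).2 hx)
      · constructor
        · exact fun h' => (g1 i x hx h').symm
        · rintro rfl
          exact ((g2 i).resolve_left fun h' => h ((g3 i).2 h')).1
    · rcases g2 i with h | h
      · exact h ▸ hve
      · exact h.2
  have a1 := d0.switchAt hve 1
  have a2 := a1.1.switchAt hve 2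
  have a3 := a2.1.switchAt hve 3
  have hg' : [1, 2, 3].foldl (steal e) g = steal e (steal e (steal e g 1) 2) 3 := by
    simp only [List.foldl_cons, List.foldl_nil]
  have hM' : step M e = switchAt e (switchAt e (switchAt e (augment e M) 1) 2) 3 := by
    simp only [step, List.foldl_cons, List.foldl_nil]
  refine ⟨g, stealOutcome_foldl e g, ?_⟩
  rw [hg', hM']
  refine ⟨fun x hx hxe => ?_, fun x hx => ?_, fun x hx => ?_,
    fun i => ?_⟩
  · ext i
    rw [mem_label, fiber, Finset.mem_filter]
    simp only [Finset.mem_univ, true_and]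
    constructor
    · exact g1 i x hx
    · rintro rfl
      exact ((g2 i).resolve_left hxe).1
  · ext i
    rw [mem_label, fiber, Finset.mem_filter]
    simp only [Finset.mem_univ, true_and]
    exact (a3.1.mem_iff i x hx).trans eq_comm
  · ext i
    have hxe : x ≠ e := fun h => hx (h ▸ hve)
    rw [mem_label, mem_label]
    refine (a3.2 i x hx).trans ((a2.2 i x hx).trans ((a1.2 i x hx).trans ?_))
    unfold augment
    split_ifs <;> simp [hxe]
  · exact (g2 i).imp_right fun h => ⟨(hM i).2 h.1, h.2⟩

end Labels

/-! ### The arrival of an edge, in terms of labels -/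

section Outcome

variable {V : Type*} [DecidableEq V]

/-- The effect on the labels `S` of the arrival of the edge `e` at the vertex `v` of the revealed
edges `E`; the indices in `F` are those that are free at `v`. -/
structure Arrival (E : Finset (Sym2 V)) (e : Sym2 V) (v : V) (F : Finset (Fin 4))
    (S S' : Sym2 V → Finset (Fin 4)) : Prop where
  free : ∀ i, i ∈ F ↔ ∀ f ∈ E, v ∈ f → i ∉ S f
  cases :
    ((∀ x ∈ E, S' x = S x) ∧ S' e = F ∧ ∀ f ∈ E, v ∈ f → (S f).card ≤ F.card + 1) ∨
    ∃ f ∈ E, v ∈ f ∧ (∀ x ∈ E, x ≠ f → S' x = S x) ∧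
      (((S' f).card = 2 ∧ 1 ∉ S' f ∧ ((S f).card = 4 ∧ (S' e).card = 2 ∨
          (S f).card = 3 ∧ ((S' e).card = 2 ∨ (S' e).card = 1 ∧ F = ∅))) ∨
        ((S f).card = 2 ∧ F = ∅ ∧ (S' e).card = 1 ∧ (S' f).card = 1 ∧
          ∀ h ∈ E, v ∈ h → h ≠ f → (S h).card = 2 → 1 ∈ S f))

theorem AreMatchings.arrival {E : Finset (Sym2 V)} {M : Fin 4 → Finset (Sym2 V)}
    (hM : AreMatchings E M) {v w : V} (hw : ∀ f ∈ E, w ∉ f) :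
    ∃ F, Arrival E s(v, w) v F (label M) (label (OnlineMatching.step M s(v, w))) := by
  obtain ⟨g, ho, h1, h2, h3, h4⟩ := exists_step_describes hM (v := v) hw
  set e := s(v, w) with he
  set g' := [1, 2, 3].foldl (steal e) g
  have hve : v ∈ e := by simp [he]
  have hE : ∀ x ∈ E, x ≠ e := fun x hx hxe => hw x hx (by simp [hxe, he])
  have mf : ∀ (k : Fin 4 → Sym2 V) a i, i ∈ fiber k a ↔ k i = a := fun k a i => by simp [fiber]
  refine ⟨fiber g e, fun i => ?_, ?_⟩
  · rw [mf]
    constructor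
    · intro hi f hf hvf hif
      rw [h1 f hvf (hE f hf), mf, hi] at hif
      exact hE f hf hif.symm
    · intro h
      refine (h4 i).resolve_right fun hh => h _ hh.1 hh.2 ?_
      rw [h1 _ hh.2 (hE _ hh.1), mf]
  · rcases ho with ⟨ho, hle⟩ | ⟨i, hi, hg, ho⟩
    · left
      rw [ho] at h2
      refine ⟨fun x hx => ?_, h2 e hve, fun f hf hvf => ?_⟩
      · by_cases hvx : v ∈ x
        · rw [h1 x hvx (hE x hx), h2 x hvx]
        · exact h3 x hvx
      · rw [h1 f hvf (hE f hf)]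
        rcases (fiber g f).eq_empty_or_nonempty with hemp | ⟨j, hj⟩
        · simp [hemp]
        · rw [mf] at hj
          rw [← hj]
          exact hle j (hj ▸ hE f hf)
    · right
      obtain ⟨hfE, hvf⟩ := (h4 i).resolve_left hi
      have hother : ∀ x, x ≠ e → x ≠ g i → fiber g' x = fiber g x := by
        intro x hxe hxf
        ext j
        rw [mf, mf]
        rcases hg j with hj | ⟨hj, hj'⟩
        · rw [hj]
        · rw [hj, hj']
          exact ⟨fun h => absurd h.symm hxe, fun h => absurd h.symm hxf⟩
      refine ⟨g i, hfE, hvf, fun x hx hxf => ?_, ?_⟩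
      · by_cases hvx : v ∈ x
        · rw [h1 x hvx (hE x hx), h2 x hvx, hother x (hE x hx) hxf]
        · exact h3 x hvx
      · rw [h2 _ hvf, h2 e hve, h1 _ hvf hi, mf, mf]
        rcases ho with (⟨a1, a2, a3, a4⟩ | ⟨a1, a2, a3, a4⟩ | ⟨a1, a2, a3, a4, a5⟩) |
          ⟨a1, a2, a3, a4, a5⟩
        · exact Or.inl ⟨a3, a4, Or.inl ⟨a1, a2⟩⟩
        · exact Or.inl ⟨a3, a4, Or.inr ⟨a1, Or.inl a2⟩⟩
        · exact Or.inl ⟨a4, a5, Or.inr ⟨a1, Or.inr ⟨a3, Finset.card_eq_zero.1 a2⟩⟩⟩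
        · refine Or.inr ⟨a1, Finset.card_eq_zero.1 a2, a3, a4, fun h hh hvh hhf hc => ?_⟩
          rw [h1 h hvh (hE h hh)] at hc
          obtain ⟨j, hj⟩ := Finset.card_pos.1 (by omega : 0 < (fiber g h).card)
          rw [mf] at hj
          exact a5 j (hj ▸ hhf) (hj ▸ hc)

end Outcome

/-! ### Live degrees and counting indices at a vertex -/

section Degrees

variable {V : Type*} [DecidableEq V]

/-- The edges at `v` with a nonempty label. -/
def incident (E : Finset (Sym2 V)) (S : Sym2 V → Finset (Fin 4)) (v : V) : Finset (Sym2 V) :=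
  E.filter fun f => v ∈ f ∧ (S f).Nonempty

/-- The number of edges at `v` with a nonempty label. -/
def deg (E : Finset (Sym2 V)) (S : Sym2 V → Finset (Fin 4)) (v : V) : ℕ := (incident E S v).card

/-- Distinct edges with a common endpoint have disjoint labels. -/
def LocallyDisjoint (S : Sym2 V → Finset (Fin 4)) : Prop :=
  ∀ (v : V) (x y : Sym2 V), v ∈ x → v ∈ y → x ≠ y → Disjoint (S x) (S y)

variable {E : Finset (Sym2 V)} {S S' : Sym2 V → Finset (Fin 4)} {v : V}

theorem mem_incident {f : Sym2 V} : f ∈ incident E S v ↔ f ∈ E ∧ v ∈ f ∧ (S f).Nonempty := by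
  simp [incident]

theorem sum_card_incident_le (hS : LocallyDisjoint S) : ∑ f ∈ incident E S v, (S f).card ≤ 4 := by
  rw [← Finset.card_biUnion]
  · exact (Finset.card_le_univ _).trans (by simp)
  · intro x hx y hy hxy
    exact hS v x y (mem_incident.1 hx).2.1 (mem_incident.1 hy).2.1 hxy

/-- Labels at `v` are disjoint sets of indices, and each live edge other than `f` uses up at least
one of the four. -/
theorem deg_add_card_le (hS : LocallyDisjoint S) {f : Sym2 V} (hf : f ∈ E) (hv : v ∈ f) :
    deg E S v + (S f).card ≤ 5 := by
  rcases (S f).eq_empty_or_nonempty with he | hne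
  · have h1 : deg E S v ≤ ∑ f ∈ incident E S v, (S f).card := by
      rw [deg, Finset.card_eq_sum_ones]
      exact Finset.sum_le_sum fun x hx => (mem_incident.1 hx).2.2.card_pos
    have := sum_card_incident_le (E := E) (v := v) hS
    simp [he]; omega
  · have hmem : f ∈ incident E S v := mem_incident.2 ⟨hf, hv, hne⟩
    have h1 : ((incident E S v).erase f).card ≤
        ∑ f ∈ (incident E S v).erase f, (S f).card := by
      rw [Finset.card_eq_sum_ones]
      exact Finset.sum_le_sum fun x hx =>
        (mem_incident.1 (Finset.mem_of_mem_erase hx)).2.2.card_pos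
    have h2 := Finset.sum_erase_add _ (fun f => (S f).card) hmem
    have h3 := Finset.card_erase_add_one hmem
    have := sum_card_incident_le (E := E) (v := v) hS
    simp only [deg]; omega

theorem four_le_card_add_sum {F : Finset (Fin 4)}
    (hF : ∀ i, i ∈ F ↔ ∀ f ∈ E, v ∈ f → i ∉ S f) :
    4 ≤ F.card + ∑ f ∈ incident E S v, (S f).card := by
  have h1 : Finset.univ ⊆ F ∪ (incident E S v).biUnion S := by
    intro i _
    rw [Finset.mem_union, hF, or_iff_not_imp_left]
    intro h
    push Not at h
    obtain ⟨f, hf, hvf, hi⟩ := h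
    exact Finset.mem_biUnion.2 ⟨f, mem_incident.2 ⟨hf, hvf, ⟨i, hi⟩⟩, hi⟩
  calc 4 = (Finset.univ : Finset (Fin 4)).card := by simp
    _ ≤ _ := Finset.card_le_card h1
    _ ≤ _ := Finset.card_union_le _ _
    _ ≤ _ := Nat.add_le_add_left Finset.card_biUnion_le _

theorem four_le_card_add_mul_deg {F : Finset (Fin 4)}
    (hF : ∀ i, i ∈ F ↔ ∀ f ∈ E, v ∈ f → i ∉ S f) {k : ℕ}
    (hk : ∀ f ∈ E, v ∈ f → (S f).card ≤ k) : 4 ≤ F.card + deg E S v * k := by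
  refine (four_le_card_add_sum hF).trans (Nat.add_le_add_left ?_ _)
  rw [deg, ← smul_eq_mul]
  exact Finset.sum_le_card_nsmul _ _ _ fun f hf =>
    hk f (mem_incident.1 hf).1 (mem_incident.1 hf).2.1

theorem deg_pos {f : Sym2 V} (hf : f ∈ E) (hv : v ∈ f) (hne : (S f).Nonempty) :
    1 ≤ deg E S v :=
  Finset.card_pos.2 ⟨f, mem_incident.2 ⟨hf, hv, hne⟩⟩

theorem deg_insert {e : Sym2 V} (heE : e ∉ E) (hne : ∀ f ∈ E, (S' f).Nonempty ↔ (S f).Nonempty)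
    (hv : v ∈ e) (he : (S' e).Nonempty) : deg (insert e E) S' v = deg E S v + 1 := by
  have h : incident (insert e E) S' v = insert e (incident E S v) := by
    ext f
    simp only [mem_incident, Finset.mem_insert]
    constructor
    · rintro ⟨rfl | hf, h1, h2⟩
      · exact Or.inl rfl
      · exact Or.inr ⟨hf, h1, (hne f hf).1 h2⟩
    · rintro (rfl | ⟨hf, h1, h2⟩)
      · exact ⟨Or.inl rfl, hv, he⟩
      · exact ⟨Or.inr hf, h1, (hne f hf).2 h2⟩
  rw [deg, h, Finset.card_insert_of_notMem fun h => heE (mem_incident.1 h).1, deg]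

theorem deg_insert_of_empty {e : Sym2 V} (hne : ∀ f ∈ E, (S' f).Nonempty ↔ (S f).Nonempty)
    (he : v ∉ e ∨ S' e = ∅) : deg (insert e E) S' v = deg E S v := by
  unfold deg
  congr 1
  ext f
  simp only [mem_incident, Finset.mem_insert]
  constructor
  · rintro ⟨rfl | hf, h1, h2⟩
    · rcases he with he | he
      · exact absurd h1 he
      · simp [he] at h2
    · exact ⟨hf, h1, (hne f hf).1 h2⟩
  · rintro ⟨hf, h1, h2⟩
    exact ⟨Or.inr hf, h1, (hne f hf).2 h2⟩

/-- Lower bounds on live degrees persist; this carries most clauses of `Invariant` through an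
arrival. -/
theorem deg_le_deg_insert {e : Sym2 V} (heE : e ∉ E)
    (hne : ∀ f ∈ E, (S' f).Nonempty ↔ (S f).Nonempty) (x : V) :
    deg E S x ≤ deg (insert e E) S' x := by
  by_cases h : x ∉ e ∨ S' e = ∅
  · rw [deg_insert_of_empty hne h]
  · push Not at h
    rw [deg_insert heE hne h.1 h.2]
    exact Nat.le_succ _

theorem incident_eq_pair {f : Sym2 V} (hf : f ∈ incident E S v) (h : deg E S v = 2) :
    ∃ h, h ≠ f ∧ h ∈ incident E S v ∧ incident E S v = {f, h} := by
  obtain ⟨a, b, hab, heq⟩ := Finset.card_eq_two.1 h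
  rw [heq] at hf ⊢
  rw [Finset.mem_insert, Finset.mem_singleton] at hf
  rcases hf with rfl | rfl
  · exact ⟨b, hab.symm, by simp, rfl⟩
  · exact ⟨a, hab, by simp, Finset.pair_comm _ _⟩

end Degrees

/-! ### The invariant and its preservation -/

section Invariant

variable {V : Type*} [DecidableEq V]

/-- The edge `f` at `x` has a label of size three, or one of size two without the index `1`, or it
had such a label of size two until it lost an index to its other endpoint. -/
def IsReserve (S : Sym2 V → Finset (Fin 4)) (t : Sym2 V → V) (l : Sym2 V → Bool) (x : V)
    (f : Sym2 V) : Prop :=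
  (S f).card = 3 ∨ (S f).card = 2 ∧ 1 ∉ S f ∨ (S f).card = 1 ∧ l f = true ∧ t f ≠ x

/-- The invariant of the four-matching algorithm on growing trees. Each revealed edge `f` has an
endpoint `u f`, its lower one, and an endpoint `t f` to which it last lost an index (the upper one
if there was no loss); `l f` records whether the label at that loss had size two and missed the index `1`. -/
structure Invariant (E : Finset (Sym2 V)) (S : Sym2 V → Finset (Fin 4)) (u t : Sym2 V → V)
    (l : Sym2 V → Bool) : Prop where
  u_mem : ∀ f ∈ E, u f ∈ f
  t_mem : ∀ f ∈ E, t f ∈ f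
  u_unique : ∀ f ∈ E, ∀ h ∈ E, (S f).Nonempty → (S h).Nonempty → u f = u h → f = h
  reserve : ∀ x, 2 ≤ deg E S x → 4 ≤ deg E S x ∨ ∃ f ∈ E, x ∈ f ∧ IsReserve S t l x f
  three_le : ∀ f ∈ E, (S f).card = 1 → l f = false → 3 ≤ deg E S (t f)
  four_le : ∀ f ∈ E, (S f).card = 1 → l f = true → 4 ≤ deg E S (t f)
  l_unique : ∀ f ∈ E, ∀ h ∈ E, (S f).card = 1 → (S h).card = 1 → l f = true → l h = true →
    t f = t h → f = h
  two_le : ∀ f ∈ E, (S f).card = 2 ∨ (S f).card = 3 → ∀ x ∈ f, x ≠ u f → 2 ≤ deg E S x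
  empty : ∀ f ∈ E, S f = ∅ → ∃ x ∈ f, 4 ≤ deg E S x

variable {E : Finset (Sym2 V)} {S S' : Sym2 V → Finset (Fin 4)} {u t : Sym2 V → V}
  {l : Sym2 V → Bool} {v w : V} {F : Finset (Fin 4)}

/-- Without a switch, labels at `v` have size at most `|F| + 1`, while together with `F` they cover
all four indices. A small `F` therefore forces a large degree at `v`; in particular `F = ∅` forces
degree 4. -/
theorem Invariant.of_no_switch (h : Invariant E S u t l)
    (hS' : LocallyDisjoint S') (hw : ∀ f ∈ E, w ∉ f)
    (hF : ∀ i, i ∈ F ↔ ∀ f ∈ E, v ∈ f → i ∉ S f) (h1 : ∀ x ∈ E, S' x = S x)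
    (h2 : S' s(v, w) = F) (h3 : ∀ f ∈ E, v ∈ f → (S f).card ≤ F.card + 1) :
    Invariant (insert s(v, w) E) S' (Function.update u s(v, w) w) (Function.update t s(v, w) v)
      (Function.update l s(v, w) false) := by
  set e := s(v, w) with he
  have hve : v ∈ e := by simp [he]
  have hwe : w ∈ e := by simp [he]
  have heE : e ∉ E := fun hh => hw e hh hwe
  have hE : ∀ x ∈ E, x ≠ e := fun x hx hxe => heE (hxe ▸ hx)
  have hne : ∀ f ∈ E, (S' f).Nonempty ↔ (S f).Nonempty := fun f hf => by rw [h1 f hf]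
  have hdeg := deg_le_deg_insert heE hne
  have hdv := fun hh => deg_insert (v := v) heE hne hve hh
  have hcov := four_le_card_add_mul_deg hF h3
  have hw0 : deg E S w = 0 := by
    rw [deg, Finset.card_eq_zero, Finset.eq_empty_iff_forall_notMem]
    exact fun f hf => hw f (mem_incident.1 hf).1 (mem_incident.1 hf).2.1
  have hFc : F.card ≤ 4 := (Finset.card_le_univ _).trans (by simp)
  have hkeep : ∀ x, (∃ f ∈ E, x ∈ f ∧ IsReserve S t l x f) → ∃ f ∈ insert e E, x ∈ f ∧
      IsReserve S' (Function.update t e v) (Function.update l e false) x f := by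
    rintro x ⟨f, hf, hxf, hr⟩
    refine ⟨f, Finset.mem_insert_of_mem hf, hxf, ?_⟩
    simpa [IsReserve, h1 f hf, hE f hf] using hr
  have hle5 := deg_add_card_le (E := insert e E) (v := v) hS' (Finset.mem_insert_self e E) hve
  refine ⟨?_, ?_, ?_, ?_, ?_, ?_, ?_, ?_, ?_⟩
  · intro f hf
    rcases Finset.mem_insert.1 hf with rfl | hf
    · simpa using hwe
    · simpa [hE f hf] using h.u_mem f hf
  · intro f hf
    rcases Finset.mem_insert.1 hf with rfl | hf
    · simpa using hve
    · simpa [hE f hf] using h.t_mem f hf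
  · intro f hf k hk nf nk huk
    rcases Finset.mem_insert.1 hf with rfl | hf <;> rcases Finset.mem_insert.1 hk with rfl | hk
    · rfl
    · simp only [Function.update_self, Function.update_of_ne (hE k hk)] at huk
      exact absurd (huk ▸ h.u_mem k hk) (hw k hk)
    · simp only [Function.update_self, Function.update_of_ne (hE f hf)] at huk
      exact absurd (huk ▸ h.u_mem f hf) (hw f hf)
    · simp only [Function.update_of_ne (hE f hf), Function.update_of_ne (hE k hk)] at huk
      exact h.u_unique f hf k hk ((hne f hf).1 nf) ((hne k hk).1 nk) huk
  · intro x hx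
    by_cases hxe : x ∈ e
    · rw [he, Sym2.mem_iff] at hxe
      rcases hxe with rfl | rfl
      · rcases F.eq_empty_or_nonempty with hemp | hFne
        · left
          have := hdeg x
          simp only [hemp, Finset.card_empty] at hcov
          omega
        · have hd := hdv (h2 ▸ hFne)
          have hFpos := hFne.card_pos
          have hself : IsReserve S' (Function.update t e x) (Function.update l e false) x e →
              ∃ f ∈ insert e E, x ∈ f ∧
                IsReserve S' (Function.update t e x) (Function.update l e false) x f :=
            fun hr => ⟨e, Finset.mem_insert_self e E, hve, hr⟩
          rw [h2] at hle5
          by_cases h2d : 2 ≤ deg E S x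
          · rcases h.reserve x h2d with h4 | hr
            · exact Or.inl (h4.trans (hdeg x))
            · exact Or.inr (hkeep x hr)
          · right
            have hd1 : deg E S x = 1 := by omega
            obtain ⟨f, hf⟩ := Finset.card_eq_one.1 hd1
            have hfm : f ∈ incident E S x := by simp [hf]
            obtain ⟨hfE, hxf, hfne⟩ := mem_incident.1 hfm
            have hsum := four_le_card_add_sum hF
            rw [hf, Finset.sum_singleton] at hsum
            have hfc := h3 f hfE hxf
            have hdis := hS' x e f hve hxf (hE f hfE).symm
            rw [h2, h1 f hfE] at hdis
            have hcd : F.card + (S f).card ≤ 4 := by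
              rw [← Finset.card_union_of_disjoint hdis]
              exact (Finset.card_le_univ _).trans (by simp)
            -- The only live edge `f` satisfies `|F| + |S f| = 4` and `|S f| ≤ |F| + 1`, leaving the
            -- splits 3+1 and 2+2. In the latter, one of the two disjoint labels misses `1`.
            by_cases hF3 : F.card = 3
            · exact hself (Or.inl (h2 ▸ hF3))
            · have hF2 : F.card = 2 := by
                have := hfne.card_pos; omega
              by_cases h1F : 1 ∈ F
              · refine ⟨f, Finset.mem_insert_of_mem hfE, hxf, Or.inr (Or.inl ?_)⟩
                rw [h1 f hfE]
                exact ⟨by omega, Finset.disjoint_left.1 hdis h1F⟩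
              · exact hself (Or.inr (Or.inl (by rw [h2]; exact ⟨hF2, h1F⟩)))
      · by_cases hS'e : (S' e).Nonempty
        · rw [deg_insert heE hne hwe hS'e] at hx
          omega
        · rw [deg_insert_of_empty hne (Or.inr (Finset.not_nonempty_iff_eq_empty.1 hS'e))] at hx
          omega
    · rw [deg_insert_of_empty hne (Or.inl hxe)] at hx ⊢
      exact (h.reserve x hx).imp_right (hkeep x)
  · intro f hf hc hl
    rcases Finset.mem_insert.1 hf with rfl | hf
    · rw [h2] at hc
      rw [Function.update_self, hdv (h2 ▸ Finset.card_pos.1 (by omega))]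
      rw [hc] at hcov
      omega
    · rw [Function.update_of_ne (hE f hf)] at hl ⊢
      exact (h.three_le f hf (h1 f hf ▸ hc) hl).trans (hdeg _)
  · intro f hf hc hl
    rcases Finset.mem_insert.1 hf with rfl | hf
    · simp at hl
    · rw [Function.update_of_ne (hE f hf)] at hl ⊢
      exact (h.four_le f hf (h1 f hf ▸ hc) hl).trans (hdeg _)
  · intro f hf k hk cf ck lf lk htk
    rcases Finset.mem_insert.1 hf with rfl | hf
    · simp at lf
    rcases Finset.mem_insert.1 hk with rfl | hk
    · simp at lk
    rw [Function.update_of_ne (hE f hf)] at lf htk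
    rw [Function.update_of_ne (hE k hk)] at lk htk
    exact h.l_unique f hf k hk (h1 f hf ▸ cf) (h1 k hk ▸ ck) lf lk htk
  · intro f hf hc x hxf hxu
    rcases Finset.mem_insert.1 hf with rfl | hf
    · rw [Function.update_self] at hxu
      rw [he, Sym2.mem_iff] at hxf
      obtain rfl := hxf.resolve_right hxu
      rw [h2] at hc
      rw [hdv (h2 ▸ Finset.card_pos.1 (by omega))]
      by_contra hlt
      have : deg E S x = 0 := by omega
      rw [this] at hcov
      omega
    · rw [Function.update_of_ne (hE f hf)] at hxu
      exact (h.two_le f hf (h1 f hf ▸ hc) x hxf hxu).trans (hdeg _)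
  · intro f hf hc
    rcases Finset.mem_insert.1 hf with rfl | hf
    · refine ⟨v, hve, le_trans ?_ (hdeg v)⟩
      rw [← h2, hc, Finset.card_empty] at hcov
      omega
    · obtain ⟨x, hx, hx4⟩ := h.empty f hf (h1 f hf ▸ hc)
      exact ⟨x, hx, hx4.trans (hdeg x)⟩

/-- The loser `g` keeps two indices other than `1`, so it is a reserve at both ends. If it owned all
four, no other edge at `y` is live, so `y` may become its lower endpoint, and `v`, now of degree at
least 2, the upper one. The values of `t` and `l` at `g` are irrelevant because they are read only
at singleton labels. -/
theorem Invariant.of_switch_large (h : Invariant E S u t l) (hS : LocallyDisjoint S)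
    (hw : ∀ f ∈ E, w ∉ f) (hF : ∀ i, i ∈ F ↔ ∀ f ∈ E, v ∈ f → i ∉ S f) {g : Sym2 V} (hg : g ∈ E)
    {y : V} (hgy : g = s(v, y)) (h1 : ∀ x ∈ E, x ≠ g → S' x = S x) (h2 : (S' g).card = 2)
    (h3 : 1 ∉ S' g) (h4 : (S g).card = 4 ∧ (S' s(v, w)).card = 2 ∨
      (S g).card = 3 ∧ ((S' s(v, w)).card = 2 ∨ (S' s(v, w)).card = 1 ∧ F = ∅)) :
    Invariant (insert s(v, w) E) S'
      (Function.update (Function.update u g (if (S g).card = 4 then y else u g)) s(v, w) w)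
      (Function.update t s(v, w) v) (Function.update l s(v, w) false) := by
  set e := s(v, w) with he
  have hve : v ∈ e := by simp [he]
  have hwe : w ∈ e := by simp [he]
  have hvg : v ∈ g := by simp [hgy]
  have hyg : y ∈ g := by simp [hgy]
  have heE : e ∉ E := fun hh => hw e hh hwe
  have hE : ∀ x ∈ E, x ≠ e := fun x hx hxe => heE (hxe ▸ hx)
  have hne : ∀ f ∈ E, (S' f).Nonempty ↔ (S f).Nonempty := by
    intro f hf
    by_cases hfg : f = g
    · rw [hfg, ← Finset.card_pos, ← Finset.card_pos]; omega
    · rw [h1 f hf hfg]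
  have hdeg := deg_le_deg_insert heE hne
  have hgne : (S g).Nonempty := Finset.card_pos.1 (by omega)
  have hdv : deg (insert e E) S' v = deg E S v + 1 :=
    deg_insert (v := v) heE hne hve (Finset.card_pos.1 (by omega))
  have hd1 := deg_pos hg hvg hgne
  have hw0 : deg E S w = 0 := by
    rw [deg, Finset.card_eq_zero, Finset.eq_empty_iff_forall_notMem]
    exact fun f hf => hw f (mem_incident.1 hf).1 (mem_incident.1 hf).2.1
  have honly : (S g).card = 4 → ∀ k ∈ E, y ∈ k → (S k).Nonempty → k = g := by
    intro hc k hk hyk nk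
    by_contra hkg
    have := hS y k g hyk hyg hkg
    have hu : S g = Finset.univ := Finset.eq_univ_of_card _ (by simp [hc])
    obtain ⟨i, hi⟩ := nk
    exact Finset.disjoint_left.1 this hi (hu ▸ Finset.mem_univ i)
  have hsame : ∀ f ∈ E, (S' f).card = 1 → (S f).card = 1 := by
    intro f hf hc
    by_cases hfg : f = g
    · rw [hfg] at hc; omega
    · rwa [h1 f hf hfg] at hc
  refine ⟨?_, ?_, ?_, ?_, ?_, ?_, ?_, ?_, ?_⟩
  · intro f hf
    rcases Finset.mem_insert.1 hf with rfl | hf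
    · simpa using hwe
    · rw [Function.update_of_ne (hE f hf)]
      by_cases hfg : f = g
      · subst hfg
        rw [Function.update_self]
        split_ifs
        exacts [hyg, h.u_mem f hf]
      · rw [Function.update_of_ne hfg]
        exact h.u_mem f hf
  · intro f hf
    rcases Finset.mem_insert.1 hf with rfl | hf
    · simpa using hve
    · simpa [hE f hf] using h.t_mem f hf
  · have hu' : ∀ f ∈ E, Function.update u g (if (S g).card = 4 then y else u g) f ∈ f := by
      intro f hf
      by_cases hfg : f = g
      · subst hfg
        rw [Function.update_self]
        split_ifs
        exacts [hyg, h.u_mem f hf]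
      · rw [Function.update_of_ne hfg]
        exact h.u_mem f hf
    have hg' : ∀ k ∈ E, (S k).Nonempty →
        Function.update u g (if (S g).card = 4 then y else u g) k =
          (if (S g).card = 4 then y else u g) → k = g := by
      intro k hk nk huk
      by_contra hkg
      rw [Function.update_of_ne hkg] at huk
      split_ifs at huk with hc
      · exact hkg (honly hc k hk (huk ▸ h.u_mem k hk) nk)
      · exact hkg (h.u_unique k hk g hg nk hgne huk)
    intro f hf k hk nf nk huk
    rcases Finset.mem_insert.1 hf with rfl | hf <;> rcases Finset.mem_insert.1 hk with rfl | hk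
    · rfl
    · simp only [Function.update_self, Function.update_of_ne (hE k hk)] at huk
      exact absurd (huk ▸ hu' k hk) (hw k hk)
    · simp only [Function.update_self, Function.update_of_ne (hE f hf)] at huk
      exact absurd (huk ▸ hu' f hf) (hw f hf)
    · rw [hne f hf] at nf
      rw [hne k hk] at nk
      rw [Function.update_of_ne (hE f hf), Function.update_of_ne (hE k hk)] at huk
      by_cases hfg : f = g
      · subst hfg
        rw [Function.update_self] at huk
        exact (hg' k hk nk huk.symm).symm
      · by_cases hkg : k = g
        · subst hkg
          rw [Function.update_self] at huk
          exact hg' f hf nf huk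
        · rw [Function.update_of_ne hfg, Function.update_of_ne hkg] at huk
          exact h.u_unique f hf k hk nf nk huk
  · intro x hx
    by_cases hxg : x ∈ g
    · exact Or.inr ⟨g, Finset.mem_insert_of_mem hg, hxg, Or.inr (Or.inl ⟨h2, h3⟩)⟩
    · by_cases hxe : x ∈ e
      · rw [he, Sym2.mem_iff] at hxe
        rcases hxe with rfl | rfl
        · exact absurd hvg hxg
        · rw [deg_insert heE hne hwe (Finset.card_pos.1 (by omega))] at hx
          omega
      · rw [deg_insert_of_empty hne (Or.inl hxe)] at hx ⊢
        refine (h.reserve x hx).imp_right ?_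
        rintro ⟨f, hf, hxf, hr⟩
        have hfg : f ≠ g := fun hh => hxg (hh ▸ hxf)
        refine ⟨f, Finset.mem_insert_of_mem hf, hxf, ?_⟩
        simpa [IsReserve, h1 f hf hfg, hE f hf] using hr
  · intro f hf hc hl
    rcases Finset.mem_insert.1 hf with rfl | hf
    · rw [Function.update_self, hdv]
      have h5 : F = ∅ ∧ (S g).card = 3 := by
        rcases h4 with h4 | ⟨h4, h5 | h5⟩
        · omega
        · omega
        · exact ⟨h5.2, h4⟩
      by_contra hlt
      have hd : deg E S v = 1 := by omega
      obtain ⟨f, hf⟩ := Finset.card_eq_one.1 hd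
      have hgm : g ∈ incident E S v := mem_incident.2 ⟨hg, hvg, hgne⟩
      rw [hf, Finset.mem_singleton] at hgm
      have hsum := four_le_card_add_sum hF
      rw [hf, Finset.sum_singleton, ← hgm, h5.1, h5.2] at hsum
      simp at hsum
    · rw [Function.update_of_ne (hE f hf)] at hl ⊢
      exact (h.three_le f hf (hsame f hf hc) hl).trans (hdeg _)
  · intro f hf hc hl
    rcases Finset.mem_insert.1 hf with rfl | hf
    · simp at hl
    · rw [Function.update_of_ne (hE f hf)] at hl ⊢
      exact (h.four_le f hf (hsame f hf hc) hl).trans (hdeg _)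
  · intro f hf k hk cf ck lf lk htk
    rcases Finset.mem_insert.1 hf with rfl | hf
    · simp at lf
    rcases Finset.mem_insert.1 hk with rfl | hk
    · simp at lk
    rw [Function.update_of_ne (hE f hf)] at lf htk
    rw [Function.update_of_ne (hE k hk)] at lk htk
    exact h.l_unique f hf k hk (hsame f hf cf) (hsame k hk ck) lf lk htk
  · intro f hf hc x hxf hxu
    rcases Finset.mem_insert.1 hf with rfl | hf
    · rw [Function.update_self] at hxu
      rw [he, Sym2.mem_iff] at hxf
      obtain rfl := hxf.resolve_right hxu
      omega
    · rw [Function.update_of_ne (hE f hf)] at hxu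
      by_cases hfg : f = g
      · subst hfg
        rw [Function.update_self] at hxu
        split_ifs at hxu with h4'
        · rw [hgy, Sym2.mem_iff] at hxf
          obtain rfl := hxf.resolve_right hxu
          omega
        · exact (h.two_le f hf (by omega) x hxf hxu).trans (hdeg _)
      · rw [Function.update_of_ne hfg] at hxu
        exact (h.two_le f hf (h1 f hf hfg ▸ hc) x hxf hxu).trans (hdeg _)
  · intro f hf hc
    rcases Finset.mem_insert.1 hf with rfl | hf
    · rw [hc, Finset.card_empty] at h4; omega
    · by_cases hfg : f = g
      · rw [hfg] at hc; simp [hc] at h2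
      · obtain ⟨x, hx, hx4⟩ := h.empty f hf (h1 f hf hfg ▸ hc)
        exact ⟨x, hx, hx4.trans (hdeg x)⟩

/-- If `v` had two live edges, both labels have size 2 and the tie-break takes from the one with
`1`; the other is a reserve at `v`. Otherwise `v` reaches degree 4. Hence a set flag comes with
degree 4 at `v`, and it keeps `g` a reserve at its other endpoint if it was one. -/
theorem Invariant.of_switch_small (h : Invariant E S u t l) (hS : LocallyDisjoint S)
    (hw : ∀ f ∈ E, w ∉ f) (hF : ∀ i, i ∈ F ↔ ∀ f ∈ E, v ∈ f → i ∉ S f) {g : Sym2 V} (hg : g ∈ E)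
    (hvg : v ∈ g) (h1 : ∀ x ∈ E, x ≠ g → S' x = S x) (h2 : (S g).card = 2) (h3 : F = ∅)
    (h4 : (S' s(v, w)).card = 1) (h5 : (S' g).card = 1)
    (h6 : ∀ k ∈ E, v ∈ k → k ≠ g → (S k).card = 2 → 1 ∈ S g) :
    Invariant (insert s(v, w) E) S' (Function.update u s(v, w) w)
      (Function.update (Function.update t g v) s(v, w) v)
      (Function.update (Function.update l g (decide (1 ∉ S g))) s(v, w) false) := by
  set e := s(v, w) with he
  have hve : v ∈ e := by simp [he]
  have hwe : w ∈ e := by simp [he]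
  have heE : e ∉ E := fun hh => hw e hh hwe
  have hE : ∀ x ∈ E, x ≠ e := fun x hx hxe => heE (hxe ▸ hx)
  have hne : ∀ f ∈ E, (S' f).Nonempty ↔ (S f).Nonempty := by
    intro f hf
    by_cases hfg : f = g
    · rw [hfg, ← Finset.card_pos, ← Finset.card_pos]; omega
    · rw [h1 f hf hfg]
  have hdeg := deg_le_deg_insert heE hne
  have hgne : (S g).Nonempty := Finset.card_pos.1 (by omega)
  have hdv : deg (insert e E) S' v = deg E S v + 1 :=
    deg_insert (v := v) heE hne hve (Finset.card_pos.1 (by omega))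
  have hgm : g ∈ incident E S v := mem_incident.2 ⟨hg, hvg, hgne⟩
  have hsum := four_le_card_add_sum hF
  rw [h3, Finset.card_empty, zero_add] at hsum
  have hw0 : deg E S w = 0 := by
    rw [deg, Finset.card_eq_zero, Finset.eq_empty_iff_forall_notMem]
    exact fun f hf => hw f (mem_incident.1 hf).1 (mem_incident.1 hf).2.1
  have hdle := deg_add_card_le hS hg hvg
  have hd1 := deg_pos hg hvg hgne
  have hd2 : 2 ≤ deg E S v := by
    by_contra hlt
    have hd : deg E S v = 1 := by omega
    obtain ⟨f, hf⟩ := Finset.card_eq_one.1 hd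
    rw [hf, Finset.mem_singleton] at hgm
    rw [hf, Finset.sum_singleton, ← hgm, h2] at hsum
    omega
  have hpair : deg E S v = 2 → 1 ∈ S g ∧ ∃ k ∈ E, v ∈ k ∧ k ≠ g ∧ (S k).card = 2 ∧ 1 ∉ S k := by
    intro hd
    obtain ⟨k, hkg, hk, heq⟩ := incident_eq_pair hgm hd
    obtain ⟨hkE, hvk, -⟩ := mem_incident.1 hk
    rw [heq, Finset.sum_pair hkg.symm, h2] at hsum
    have hle := sum_card_incident_le (E := E) (v := v) hS
    rw [heq, Finset.sum_pair hkg.symm, h2] at hle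
    have hk2 : (S k).card = 2 := by omega
    have h1g := h6 k hkE hvk hkg hk2
    exact ⟨h1g, k, hkE, hvk, hkg, hk2, Finset.disjoint_left.1 (hS v g k hvg hvk hkg.symm) h1g⟩
  have hother : ∀ f ∈ E, f ≠ g → Function.update (Function.update t g v) e v f = t f ∧
      Function.update (Function.update l g (decide (1 ∉ S g))) e false f = l f := by
    intro f hf hfg
    simp [hE f hf, hfg]
  have hself : Function.update (Function.update t g v) e v g = v ∧
      Function.update (Function.update l g (decide (1 ∉ S g))) e false g = decide (1 ∉ S g) := by
    simp [hE g hg]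
  refine ⟨?_, ?_, ?_, ?_, ?_, ?_, ?_, ?_, ?_⟩
  · intro f hf
    rcases Finset.mem_insert.1 hf with rfl | hf
    · simpa using hwe
    · simpa [hE f hf] using h.u_mem f hf
  · intro f hf
    rcases Finset.mem_insert.1 hf with rfl | hf
    · simpa using hve
    · by_cases hfg : f = g
      · rw [hfg, hself.1]; exact hvg
      · rw [(hother f hf hfg).1]; exact h.t_mem f hf
  · intro f hf k hk nf nk huk
    rcases Finset.mem_insert.1 hf with rfl | hf <;> rcases Finset.mem_insert.1 hk with rfl | hk
    · rfl
    · simp only [Function.update_self, Function.update_of_ne (hE k hk)] at huk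
      exact absurd (huk ▸ h.u_mem k hk) (hw k hk)
    · simp only [Function.update_self, Function.update_of_ne (hE f hf)] at huk
      exact absurd (huk ▸ h.u_mem f hf) (hw f hf)
    · simp only [Function.update_of_ne (hE f hf), Function.update_of_ne (hE k hk)] at huk
      exact h.u_unique f hf k hk ((hne f hf).1 nf) ((hne k hk).1 nk) huk
  · intro x hx
    by_cases hxv : x = v
    · subst hxv
      by_cases hd : deg E S x = 2
      · obtain ⟨-, k, hk, hvk, hkg, hk2, hk1⟩ := hpair hd
        refine Or.inr ⟨k, Finset.mem_insert_of_mem hk, hvk, Or.inr (Or.inl ?_)⟩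
        rw [h1 k hk hkg]
        exact ⟨hk2, hk1⟩
      · left; omega
    · by_cases hxe : x ∈ e
      · rw [he, Sym2.mem_iff] at hxe
        obtain rfl := hxe.resolve_left hxv
        rw [deg_insert heE hne hwe (Finset.card_pos.1 (by omega))] at hx
        omega
      · rw [deg_insert_of_empty hne (Or.inl hxe)] at hx ⊢
        refine (h.reserve x hx).imp_right ?_
        rintro ⟨f, hf, hxf, hr⟩
        refine ⟨f, Finset.mem_insert_of_mem hf, hxf, ?_⟩
        by_cases hfg : f = g
        · subst hfg
          refine Or.inr (Or.inr ⟨h5, ?_, ?_⟩)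
          · rw [hself.2]
            rcases hr with hr | hr | hr
            · omega
            · simpa using hr.2
            · omega
          · rw [hself.1]; exact Ne.symm hxv
        · rw [IsReserve, (hother f hf hfg).1, (hother f hf hfg).2, h1 f hf hfg]
          exact hr
  · intro f hf hc hl
    rcases Finset.mem_insert.1 hf with rfl | hf
    · rw [Function.update_self]; omega
    · by_cases hfg : f = g
      · rw [hfg, hself.1]; omega
      · rw [(hother f hf hfg).2] at hl
        rw [(hother f hf hfg).1]
        exact (h.three_le f hf (h1 f hf hfg ▸ hc) hl).trans (hdeg _)
  · intro f hf hc hl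
    rcases Finset.mem_insert.1 hf with rfl | hf
    · simp at hl
    · by_cases hfg : f = g
      · rw [hfg, hself.2] at hl
        rw [hfg, hself.1]
        by_contra hlt
        exact of_decide_eq_true hl (hpair (by omega)).1
      · rw [(hother f hf hfg).2] at hl
        rw [(hother f hf hfg).1]
        exact (h.four_le f hf (h1 f hf hfg ▸ hc) hl).trans (hdeg _)
  -- As `g` held two indices, `v` had degree at most 3 before; an earlier flagged loss at `v` would
  -- have required degree 4.
  · have hv : ∀ f ∈ E, f ≠ g → (S' f).card = 1 → l f = true → t f ≠ v := by
      intro f hf hfg cf lf htv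
      have := h.four_le f hf (h1 f hf hfg ▸ cf) lf
      rw [htv] at this
      omega
    intro f hf k hk cf ck lf lk htk
    rcases Finset.mem_insert.1 hf with rfl | hf
    · simp at lf
    rcases Finset.mem_insert.1 hk with rfl | hk
    · simp at lk
    by_cases hfg : f = g
    · by_cases hkg : k = g
      · rw [hfg, hkg]
      · rw [hfg, hself.1, (hother k hk hkg).1] at htk
        rw [(hother k hk hkg).2] at lk
        exact absurd htk.symm (hv k hk hkg ck lk)
    · rw [(hother f hf hfg).2] at lf
      by_cases hkg : k = g
      · rw [hkg, hself.1, (hother f hf hfg).1] at htk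
        exact absurd htk (hv f hf hfg cf lf)
      · rw [(hother k hk hkg).2] at lk
        rw [(hother f hf hfg).1, (hother k hk hkg).1] at htk
        exact h.l_unique f hf k hk (h1 f hf hfg ▸ cf) (h1 k hk hkg ▸ ck) lf lk htk
  · intro f hf hc x hxf hxu
    rcases Finset.mem_insert.1 hf with rfl | hf
    · omega
    · rw [Function.update_of_ne (hE f hf)] at hxu
      by_cases hfg : f = g
      · rw [hfg] at hc; omega
      · exact (h.two_le f hf (h1 f hf hfg ▸ hc) x hxf hxu).trans (hdeg _)
  · intro f hf hc
    rcases Finset.mem_insert.1 hf with rfl | hf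
    · rw [hc, Finset.card_empty] at h4; omega
    · by_cases hfg : f = g
      · rw [hfg] at hc; simp [hc] at h5
      · obtain ⟨x, hx, hx4⟩ := h.empty f hf (h1 f hf hfg ▸ hc)
        exact ⟨x, hx, hx4.trans (hdeg x)⟩

theorem Invariant.arrival (h : Invariant E S u t l) (hS : LocallyDisjoint S)
    (hS' : LocallyDisjoint S') (hw : ∀ f ∈ E, w ∉ f) (ha : Arrival E s(v, w) v F S S') :
    ∃ u' t' l', Invariant (insert s(v, w) E) S' u' t' l' := by
  rcases ha.cases with ⟨h1, h2, h3⟩ | ⟨g, hg, hvg, h1, ⟨h2, h3, h4⟩ | ⟨h2, h3, h4, h5, h6⟩⟩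
  · exact ⟨_, _, _, h.of_no_switch hS' hw ha.free h1 h2 h3⟩
  · obtain ⟨y, hgy⟩ := Sym2.mem_iff_exists.1 hvg
    exact ⟨_, _, _, h.of_switch_large hS hw ha.free hg hgy h1 h2 h3 h4⟩
  · exact ⟨_, _, _, h.of_switch_small hS hw ha.free hg hvg h1 h2 h3 h4 h5 h6⟩

end Invariant

/-! ### The charging scheme -/

section Shares

variable {V : Type*} [DecidableEq V]

/-- The part of the value of the edge `f` that is assigned to the vertex `x`. -/
def share (S : Sym2 V → Finset (Fin 4)) (u t : Sym2 V → V) (l : Sym2 V → Bool) (f : Sym2 V)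
    (x : V) : ℕ :=
  if x ∈ f then
    if (S f).card = 1 then
      if l f then
        if t f = x then if u f = x then 0 else 2
        else if u f = x then 2 else 4
      else if u f = x then 1 else 3
    else 2 * (S f).card
  else 0

/-- The total value that is assigned to the vertex `x`. -/
def weight (E : Finset (Sym2 V)) (S : Sym2 V → Finset (Fin 4)) (u t : Sym2 V → V)
    (l : Sym2 V → Bool) (x : V) : ℕ :=
  ∑ f ∈ E, share S u t l f x

variable {E : Finset (Sym2 V)} {S : Sym2 V → Finset (Fin 4)} {u t : Sym2 V → V}
  {l : Sym2 V → Bool} {x y : V} {f : Sym2 V}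

theorem share_le_weight (hf : f ∈ E) : share S u t l f x ≤ weight E S u t l x :=
  Finset.single_le_sum (f := fun f => share S u t l f x) (fun _ _ => Nat.zero_le _) hf

/-- For singleton labels the split 1+3 stays within 4, and the flag merely moves one unit from `t f`
to the other endpoint, giving 0+4 or 2+2. -/
theorem Invariant.sum_share_le (h : Invariant E S u t l) (hf : f ∈ E) (hd : ¬ f.IsDiag) :
    ∑ x ∈ f.toFinset, share S u t l f x ≤ 4 * (S f).card := by
  induction f with | _ x y =>
  have hxy : x ≠ y := by simpa using hd
  have hu := h.u_mem _ hf
  have ht := h.t_mem _ hf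
  have hs : (s(x, y)).toFinset = {x, y} := by ext; simp
  rw [hs, Finset.sum_pair hxy]
  rw [Sym2.mem_iff] at hu ht
  simp only [share, Sym2.mem_mk_left, Sym2.mem_mk_right, if_true]
  rcases hu with hu | hu <;> rcases ht with ht | ht <;>
    simp only [hu, ht, hxy, hxy.symm, if_true, if_false] <;> split_ifs <;> omega

/-- The label of `f` has size one, and its last loss was to `x` and from a label without the
index `1`. -/
def IsCharged (S : Sym2 V → Finset (Fin 4)) (t : Sym2 V → V) (l : Sym2 V → Bool) (x : V)
    (f : Sym2 V) : Prop :=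
  (S f).card = 1 ∧ l f = true ∧ t f = x

instance : DecidablePred (IsCharged S t l x) := fun _ => by unfold IsCharged; infer_instance

/-- Three units is the norm; being the lower endpoint costs at most two, a flagged loss one more. -/
theorem three_le_share (hx : x ∈ f) (hne : (S f).Nonempty) :
    3 ≤ share S u t l f x + 2 * (if u f = x then 1 else 0) +
      (if IsCharged S t l x f then 1 else 0) := by
  have := hne.card_pos
  unfold share IsCharged
  rw [if_pos hx]
  split_ifs <;> first | omega | simp_all

theorem IsReserve.four_le_share (hr : IsReserve S t l x f) (hx : x ∈ f) :
    4 ≤ share S u t l f x + 2 * (if u f = x then 1 else 0) := by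
  unfold share
  rw [if_pos hx]
  rcases hr with h | h | h
  · simp [h]; omega
  · simp [h.1]
  · simp only [h.1, h.2.1, h.2.2, if_true, if_false]; split_ifs <;> omega

theorem sum_ite_le_one (p : Sym2 V → Prop) [DecidablePred p]
    (hp : ∀ f ∈ incident E S x, ∀ k ∈ incident E S x, p f → p k → f = k) :
    ∑ f ∈ incident E S x, (if p f then 1 else 0) ≤ 1 := by
  rw [← Finset.card_filter, Finset.card_le_one]
  intro a ha b hb
  rw [Finset.mem_filter] at ha hb
  exact hp a ha.1 b hb.1 ha.2 hb.2

theorem sum_incident_share_le : ∑ f ∈ incident E S x, share S u t l f x ≤ weight E S u t l x :=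
  Finset.sum_le_sum_of_subset (Finset.filter_subset _ _)

theorem Invariant.sum_u_le_one (h : Invariant E S u t l) :
    ∑ f ∈ incident E S x, (if u f = x then 1 else 0) ≤ 1 := by
  refine sum_ite_le_one _ fun f hf k hk huf huk => ?_
  rw [mem_incident] at hf hk
  exact h.u_unique f hf.1 k hk.1 hf.2.2 hk.2.2 (huf.trans huk.symm)

/-- `4·3 - 2 - 1`, since both deductions occur at most once at `x`. -/
theorem Invariant.nine_le_weight (h : Invariant E S u t l) (hd : 4 ≤ deg E S x) :
    9 ≤ weight E S u t l x := by
  have h1 := h.sum_u_le_one (x := x)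
  have h2 : ∑ f ∈ incident E S x, (if IsCharged S t l x f then 1 else 0) ≤ 1 := by
    refine sum_ite_le_one _ fun f hf k hk hcf hck => ?_
    exact h.l_unique f (mem_incident.1 hf).1 k (mem_incident.1 hk).1 hcf.1 hck.1 hcf.2.1 hck.2.1
      (hcf.2.2.trans hck.2.2.symm)
  have h3 := Finset.card_nsmul_le_sum (incident E S x) _ 3 fun f hf =>
    three_le_share (u := u) (t := t) (l := l) (mem_incident.1 hf).2.1 (mem_incident.1 hf).2.2
  rw [Finset.sum_add_distrib, Finset.sum_add_distrib, ← Finset.mul_sum, smul_eq_mul] at h3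
  have h4 := sum_incident_share_le (E := E) (S := S) (u := u) (t := t) (l := l) (x := x)
  unfold deg at hd
  omega

/-- A vertex that is not saturated gets at least three units from each edge, except for two units
that may be missing at the edge above it. -/
theorem Invariant.deg_le_weight (h : Invariant E S u t l) (hd : deg E S x < 4)
    (hf : f ∈ incident E S x)
    (h4 : 4 ≤ share S u t l f x + 2 * (if u f = x then 1 else 0)) :
    3 * deg E S x ≤ weight E S u t l x + 1 := by
  have h1 := h.sum_u_le_one (x := x)
  have h3 : ∀ k ∈ (incident E S x).erase f,
      3 ≤ share S u t l k x + 2 * (if u k = x then 1 else 0) := by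
    intro k hk
    obtain ⟨hkE, hxk, hkne⟩ := mem_incident.1 (Finset.mem_of_mem_erase hk)
    have h5 := three_le_share (u := u) (t := t) (l := l) hxk hkne
    -- A flagged loss at `x` would force degree 4, so this deduction is absent here.
    have hc : ¬ IsCharged S t l x k := by
      intro hc
      have := h.four_le k hkE hc.1 hc.2.1
      rw [hc.2.2] at this
      omega
    rwa [if_neg hc] at h5
  have h5 := Finset.card_nsmul_le_sum _ _ 3 h3
  have h6 := Finset.sum_erase_add _ (fun k => share S u t l k x + 2 * (if u k = x then 1 else 0)) hf
  rw [Finset.sum_add_distrib (s := incident E S x), ← Finset.mul_sum] at h6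
  have h7 := sum_incident_share_le (E := E) (S := S) (u := u) (t := t) (l := l) (x := x)
  have h8 := Finset.card_erase_add_one hf
  rw [smul_eq_mul] at h5
  simp only [deg]
  omega

theorem Invariant.eight_le_weight (h : Invariant E S u t l) (hd : 3 ≤ deg E S x) :
    8 ≤ weight E S u t l x := by
  by_cases h4 : 4 ≤ deg E S x
  · exact (by norm_num : 8 ≤ 9).trans (h.nine_le_weight h4)
  · obtain ⟨f, hf, hxf, hr⟩ := (h.reserve x (by omega)).resolve_left h4
    have hne : (S f).Nonempty := by
      rw [← Finset.card_pos]
      rcases hr with hr | hr | hr <;> omega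
    have := h.deg_le_weight (by omega) (mem_incident.2 ⟨hf, hxf, hne⟩) (hr.four_le_share hxf)
    omega

theorem Invariant.five_le_weight (h : Invariant E S u t l) (hd : 2 ≤ deg E S x) (hf : f ∈ E)
    (hx : x ∈ f) (hc : (S f).card = 2) : 5 ≤ weight E S u t l x := by
  by_cases h4 : 4 ≤ deg E S x
  · exact (by norm_num : 5 ≤ 9).trans (h.nine_le_weight h4)
  · have := h.deg_le_weight (by omega)
      (mem_incident.2 ⟨hf, hx, Finset.card_pos.1 (by omega)⟩) (by simp [share, hx, hc])
    omega

/-- By label size. Empty or flagged singleton: one endpoint has degree 4 and weight 9. Other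
singletons: weight 8 at `t`, plus at least 1 at the other end. Size 2: 4 below and 5 above. Size at
least 3: 6 at each end. -/
theorem Invariant.nine_le_weight_add_weight (h : Invariant E S u t l) (hf : s(x, y) ∈ E)
    (hxy : x ≠ y) : 9 ≤ weight E S u t l x + weight E S u t l y := by
  have hx := share_le_weight (S := S) (u := u) (t := t) (l := l) (x := x) hf
  have hy := share_le_weight (S := S) (u := u) (t := t) (l := l) (x := y) hf
  have hu := h.u_mem _ hf
  have ht := h.t_mem _ hf
  rw [Sym2.mem_iff] at hu ht
  simp only [share, Sym2.mem_mk_left, Sym2.mem_mk_right, if_true] at hx hy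
  have hc : (S s(x, y)).card ≤ 4 := (Finset.card_le_univ _).trans (by simp)
  obtain hc0 | hc1 | hc2 | hc3 : (S s(x, y)).card = 0 ∨ (S s(x, y)).card = 1 ∨
      (S s(x, y)).card = 2 ∨ 3 ≤ (S s(x, y)).card := by omega
  · obtain ⟨z, hz, hz4⟩ := h.empty _ hf (Finset.card_eq_zero.1 hc0)
    have := h.nine_le_weight hz4
    rcases Sym2.mem_iff.1 hz with rfl | rfl <;> omega
  · cases hl : l s(x, y) with
    | true =>
      have := h.nine_le_weight (h.four_le _ hf hc1 hl)
      rcases ht with ht | ht <;> rw [ht] at this <;> omega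
    | false =>
      have := h.eight_le_weight (h.three_le _ hf hc1 hl)
      simp only [hc1, hl, if_true] at hx hy
      rcases ht with ht | ht <;> rw [ht] at this <;> split_ifs at hx hy <;> simp_all <;> omega
  · rcases hu with hu | hu
    · have := h.five_le_weight (h.two_le _ hf (Or.inl hc2) y (by simp) (by rw [hu]; exact hxy.symm)) hf
        (by simp) hc2
      simp only [hc2] at hx
      norm_num at hx
      omega
    · have := h.five_le_weight (h.two_le _ hf (Or.inl hc2) x (by simp) (by rw [hu]; exact hxy)) hf
        (by simp) hc2
      simp only [hc2] at hy
      norm_num at hy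
      omega
  · rw [if_neg (by omega)] at hx hy
    omega

theorem Invariant.nine_mul_opt_le {σ : List (Sym2 V)} (h : Invariant σ.toFinset S u t l)
    (hd : ∀ f ∈ σ, ¬ f.IsDiag) : 9 * opt σ ≤ 4 * ∑ f ∈ σ.toFinset, (S f).card := by
  have key : ∀ N ⊆ σ.toFinset, IsMatching N →
      9 * N.card ≤ 4 * ∑ f ∈ σ.toFinset, (S f).card := by
    intro N hN hm
    set W := weight σ.toFinset S u t l with hW
    have h1 : ∀ f ∈ N, 9 ≤ ∑ x ∈ f.toFinset, W x := by
      intro f hf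
      have hfE := hN hf
      have hfd := hd f (List.mem_toFinset.1 hfE)
      induction f with | _ x y =>
      have hxy : x ≠ y := by simpa using hfd
      have hs : (s(x, y)).toFinset = {x, y} := by ext; simp
      rw [hs, Finset.sum_pair hxy]
      exact h.nine_le_weight_add_weight hfE hxy
    have hdis : (N : Set (Sym2 V)).PairwiseDisjoint Sym2.toFinset := by
      intro a ha b hb hab
      rw [Function.onFun, Finset.disjoint_left]
      exact fun x hxa hxb => hm a ha b hb ⟨hab, x, hxa, hxb⟩
    calc 9 * N.card = ∑ f ∈ N, 9 := by rw [Finset.sum_const, smul_eq_mul, mul_comm]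
      _ ≤ ∑ f ∈ N, ∑ x ∈ f.toFinset, W x := Finset.sum_le_sum h1
      _ = ∑ x ∈ N.biUnion Sym2.toFinset, W x := (Finset.sum_biUnion hdis).symm
      _ ≤ ∑ x ∈ σ.toFinset.biUnion Sym2.toFinset, W x :=
        Finset.sum_le_sum_of_subset (Finset.biUnion_subset_biUnion_of_subset_left _ hN)
      _ = ∑ f ∈ σ.toFinset, ∑ x ∈ σ.toFinset.biUnion Sym2.toFinset, share S u t l f x :=
        Finset.sum_comm
      _ = ∑ f ∈ σ.toFinset, ∑ x ∈ f.toFinset, share S u t l f x := by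
        refine Finset.sum_congr rfl fun f hf => (Finset.sum_subset
          (Finset.subset_biUnion_of_mem Sym2.toFinset hf) fun x _ hx => ?_).symm
        rw [share, if_neg (by simpa using hx)]
      _ ≤ ∑ f ∈ σ.toFinset, 4 * (S f).card :=
        Finset.sum_le_sum fun f hf => h.sum_share_le hf (hd f (List.mem_toFinset.1 hf))
      _ = _ := (Finset.mul_sum _ _ _).symm
  have hne : (σ.toFinset.powerset.filter IsMatching).Nonempty :=
    ⟨∅, by simp [IsMatching]⟩
  obtain ⟨N, hN, heq⟩ := Finset.exists_mem_eq_sup _ hne Finset.card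
  rw [Finset.mem_filter, Finset.mem_powerset] at hN
  rw [opt, heq]
  exact key N hN.1 hN.2

end Shares

/-! ### New endpoints in growing trees -/

section GrowingTree

variable {V : Type*}

theorem IsGrowingTree.of_prefix {σ τ : List (Sym2 V)} (h : IsGrowingTree σ) (hτ : τ <+: σ) :
    IsGrowingTree τ :=
  ⟨h.1.sublist hτ.sublist, fun e he => h.2.1 e (hτ.subset he),
    fun ρ hρ => h.2.2 ρ (hρ.trans hτ)⟩

theorem inputGraph_adj {σ : List (Sym2 V)} {v w : V} :
    (inputGraph σ).Adj v w ↔ s(v, w) ∈ σ ∧ v ≠ w := by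
  simp [inputGraph]

theorem IsGrowingTree.mem_support {σ : List (Sym2 V)} (h : IsGrowingTree σ) {f : Sym2 V}
    (hf : f ∈ σ) {v : V} (hv : v ∈ f) : v ∈ (inputGraph σ).support := by
  obtain ⟨w, rfl⟩ := Sym2.mem_iff_exists.1 hv
  exact (SimpleGraph.mem_support _).2
    ⟨w, inputGraph_adj.2 ⟨hf, by simpa using h.2.1 _ hf⟩⟩

/-- The edge that arrives last in a growing tree has an endpoint that is new. -/
theorem IsGrowingTree.exists_new_endpoint {σ : List (Sym2 V)} {e : Sym2 V}
    (h : IsGrowingTree (σ ++ [e])) : ∃ v w, e = s(v, w) ∧ ∀ f ∈ σ, w ∉ f := by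
  have hσ := h.of_prefix (List.prefix_append σ [e])
  induction e with | _ v w =>
  by_contra hcon
  push Not at hcon
  obtain ⟨f, hf, hwf⟩ := hcon v w rfl
  obtain ⟨k, hk, hvk⟩ := hcon w v Sym2.eq_swap
  have hvw : v ≠ w := by simpa using h.2.1 s(v, w) (by simp)
  have heσ : s(v, w) ∉ σ := fun he => by
    have := h.1
    rw [List.nodup_append] at this
    exact this.2.2 _ he _ (List.mem_singleton_self _) rfl
  have hv := hσ.mem_support hk hvk
  have hw := hσ.mem_support hf hwf
  have hadj : ∀ {a b : V}, (inputGraph σ).Adj a b →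
      (inputGraph (σ ++ [s(v, w)])).Adj a b := fun {a b} hab => by
    rw [inputGraph_adj] at hab ⊢
    exact ⟨List.mem_append_left _ hab.1, hab.2⟩
  have hsupp : ∀ {a : V}, a ∈ (inputGraph σ).support →
      a ∈ (inputGraph (σ ++ [s(v, w)])).support := fun {a} ha => by
    obtain ⟨b, hb⟩ := (SimpleGraph.mem_support _).1 ha
    exact (SimpleGraph.mem_support _).2 ⟨b, hadj hb⟩
  have hconn := (hσ.2.2 σ (List.prefix_refl σ) (List.ne_nil_of_mem hf)).connected
  have hacyc := (h.2.2 _ (List.prefix_refl _) (by simp)).isAcyclic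
  have hbridge := SimpleGraph.isAcyclic_iff_forall_adj_isBridge.1 hacyc
    (v := ⟨v, hsupp hv⟩) (w := ⟨w, hsupp hw⟩)
    (inputGraph_adj.2 ⟨by simp, hvw⟩)
  rw [SimpleGraph.isBridge_iff] at hbridge
  -- If both endpoints were old, the earlier connected graph would embed in the later tree minus the
  -- new edge, which is a bridge.
  let φ : (inputGraph σ).induce (inputGraph σ).support →g
      ((inputGraph (σ ++ [s(v, w)])).induce (inputGraph (σ ++ [s(v, w)])).support).deleteEdges
        {s(⟨v, hsupp hv⟩, ⟨w, hsupp hw⟩)} :=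
    { toFun := fun a => ⟨a.1, hsupp a.2⟩
      map_rel' := by
        intro a b hab
        rw [SimpleGraph.deleteEdges_adj]
        refine ⟨hadj hab, fun heq => heσ ?_⟩
        have h1 := congrArg (Sym2.map Subtype.val) (Set.mem_singleton_iff.1 heq)
        simp only [Sym2.map_mk] at h1
        exact h1 ▸ (inputGraph_adj.1 hab).1 }
  exact hbridge ((hconn.preconnected ⟨v, hv⟩ ⟨w, hw⟩).map φ)

end GrowingTree

/-! ### Assembly along the input sequence -/

section Main

variable {V : Type*} [DecidableEq V]

theorem matchings_append (σ : List (Sym2 V)) (e : Sym2 V) :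
    matchings (σ ++ [e]) = step (matchings σ) e := by
  simp [matchings]

theorem areMatchings_matchings (σ : List (Sym2 V)) : AreMatchings σ.toFinset (matchings σ) := by
  induction σ using List.reverseRecOn with
  | nil => exact fun i => ⟨by simp [matchings, IsMatching], by simp [matchings]⟩
  | append_singleton σ e ih =>
    rw [matchings_append, List.toFinset_append, Finset.union_comm]
    simpa using ih.step e

theorem invariant_empty (S : Sym2 V → Finset (Fin 4)) (u t : Sym2 V → V) (l : Sym2 V → Bool) :
    Invariant ∅ S u t l := by
  refine ⟨?_, ?_, ?_, fun x hx => ?_, ?_, ?_, ?_, ?_, ?_⟩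
  case refine_4 => simp [deg, incident] at hx
  all_goals simp

theorem IsGrowingTree.exists_invariant {σ : List (Sym2 V)} (h : IsGrowingTree σ) :
    ∃ u t l, Invariant σ.toFinset (label (matchings σ)) u t l := by
  induction σ using List.reverseRecOn with
  | nil =>
    -- The values are irrelevant; `out` supplies a vertex because `V` may be empty and have no
    -- constant to use.
    exact ⟨fun f => f.out.1, fun f => f.out.1, fun _ => false, invariant_empty _ _ _ _⟩
  | append_singleton σ e ih =>
    obtain ⟨u, t, l, hI⟩ := ih (h.of_prefix (List.prefix_append σ [e]))
    obtain ⟨v, w, rfl, hw⟩ := h.exists_new_endpoint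
    have hw' : ∀ f ∈ σ.toFinset, w ∉ f := fun f hf => hw f (List.mem_toFinset.1 hf)
    have hM := areMatchings_matchings σ
    obtain ⟨F, hF⟩ := hM.arrival (v := v) hw'
    have := hI.arrival (fun _ _ _ => hM.disjoint_label)
      (fun _ _ _ => (hM.step s(v, w)).disjoint_label) hw' hF
    rw [matchings_append, List.toFinset_append, Finset.union_comm]
    simpa using this

theorem sum_card_label {E : Finset (Sym2 V)} {M : Fin 4 → Finset (Sym2 V)} (hM : ∀ i, M i ⊆ E) :
    ∑ f ∈ E, (label M f).card = ∑ i, (M i).card := by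
  simp only [label, Finset.card_filter]
  rw [Finset.sum_comm]
  refine Finset.sum_congr rfl fun i _ => ?_
  rw [← Finset.card_filter, Finset.filter_mem_eq_inter, Finset.inter_eq_right.2 (hM i)]

/-- On growing trees, the four-matching algorithm is even `16/9`-competitive. -/
theorem IsGrowingTree.nine_mul_opt_le {σ : List (Sym2 V)} (h : IsGrowingTree σ) :
    9 * opt σ ≤ 4 * ∑ i, (matchings σ i).card := by
  obtain ⟨u, t, l, hI⟩ := h.exists_invariant
  rw [← sum_card_label fun i => (areMatchings_matchings σ i).2]
  exact hI.nine_mul_opt_le h.2.1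

theorem expectedSize_fourMatching (σ : List (Sym2 V)) :
    (fourMatching V).expectedSize σ = (∑ i, ((matchings σ i).card : ℝ)) / 4 := by
  simp [RandomizedAlgorithm.expectedSize, fourMatching, Fintype.sum_prod_type, bitsIndex,
    Fin.sum_univ_four]
  ring

end Main

end OnlineMatching

theorem mainTheorem1 {V : Type*} [DecidableEq V] :
    (OnlineMatching.fourMatching V).IsPreemptiveOn
        {σ : List (Sym2 V) | OnlineMatching.IsGrowingTree σ} ∧
      (OnlineMatching.fourMatching V).IsCompetitiveOn
        {σ : List (Sym2 V) | OnlineMatching.IsGrowingTree σ} (28 / 15) := by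
  refine ⟨fun b => ⟨rfl, fun σ e _ => ?_, fun σ _ => ?_⟩, fun σ hσ => ?_⟩
  · simp only [OnlineMatching.fourMatching, OnlineMatching.matchings_append]
    exact OnlineMatching.step_apply _ _ _
  · exact OnlineMatching.areMatchings_matchings σ _
  · rw [OnlineMatching.expectedSize_fourMatching]
    have h : (9 : ℝ) * OnlineMatching.opt σ ≤
        4 * ∑ i, ((OnlineMatching.matchings σ i).card : ℝ) := by
      exact_mod_cast OnlineMatching.IsGrowingTree.nine_mul_opt_le hσ
    -- Needed to weaken the factor `9/16` to `15/28`.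
    have h0 : (0 : ℝ) ≤ OnlineMatching.opt σ := Nat.cast_nonneg _
    norm_num
    linarith
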